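/- There is an absolute constant $C>0$ with the following property. Let $\mathbb H$ be a separable real Hilbert space with norm $|\cdot|$, let $Q\ge 1$, $\varepsilon>0$ and $0<\ell\le\varepsilon/2$, and let $$\mathcal D_Q^{\varepsilon,\ell}=\{V=(x,y,r,s)\in\mathbb H\times\mathbb H\times(0,\infty)\times(0,\infty):\ 1\le rs\le Q,\ \ \varepsilon\le r,s\le\varepsilon^{-1},\ \ |x|\ge\ell,\ |y|\ge\ell\}.$$ Then there are a function $B_\ell$, defined and $C^\infty$ on an open neighbourhood of $\mathcal D_Q^{\varepsilon,\ell}$ in $\mathbb H\times\mathbb H\times\mathbb R\times\mathbb R$, and a continuous function $\tau_\ell:\mathcal D_Q^{\varepsilon,\ell}\to(0,\infty)$ such that for all $V=(x,y,r,s)$ and $V_0=(x_0,y_0,r_0,s_0)$ in $\mathcal D_Q^{\varepsilon,\ell}$ and all $dV=(dx,dy,dr,ds)\in\mathbb H\times\mathbb H\times\mathbb R\times\mathbb R$: 1. (size) $0\le B_\ell(V)\le C(1+\ell)\left(\frac{|x|^2}{r}+\frac{|y|^2}{s}\right)$; 2. (continuous convexity) $(d^2B_\ell(V)\,dV,dV)\ge\frac2Q|dx||dy|$;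 3. (discrete one-leg convexity) $B_\ell(V)-B_\ell(V_0)-dB_\ell(V_0)(V-V_0)\ge\frac1Q|x-x_0||y-y_0|$; 4. (quantitative ellipse bound) $Q\,(d^2B_\ell(V)\,dV,dV)\ge\tau_\ell(V)|dx|^2+\tau_\ell(V)^{-1}|dy|^2$, with $C^{-1}Q^{-1}\varepsilon\le\tau_\ell(V)\le C\,Q\,\varepsilon^{-1}$. -/

import Mathlib

open scoped ContDiff

/-- The domain `𝒟_Q` of quadruplets `V = (x, y, r, s)` with `r, s > 0` and `1 ≤ r s ≤ Q`. -/
def weightDomain (H : Type*) (Q : ℝ) : Set (H × H × ℝ × ℝ) :=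
  {V | 0 < V.2.2.1 ∧ 0 < V.2.2.2 ∧ 1 ≤ V.2.2.1 * V.2.2.2 ∧ V.2.2.1 * V.2.2.2 ≤ Q}

/-- The domain with truncated weights: `ε ≤ r ≤ ε⁻¹` and `ε ≤ s ≤ ε⁻¹`. -/
def cutWeightDomain (H : Type*) (Q ε : ℝ) : Set (H × H × ℝ × ℝ) :=
  {V | V ∈ weightDomain H Q ∧ ε ≤ V.2.2.1 ∧ V.2.2.1 ≤ ε⁻¹ ∧ ε ≤ V.2.2.2 ∧ V.2.2.2 ≤ ε⁻¹}

/-- The part of the truncated domain where `|x| ≥ ℓ` and `|y| ≥ ℓ`. -/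
def truncatedDomain (H : Type*) [NormedAddCommGroup H] (Q ε ℓ : ℝ) : Set (H × H × ℝ × ℝ) :=
  {V | V ∈ cutWeightDomain H Q ε ∧ ℓ ≤ ‖V.1‖ ∧ ℓ ≤ ‖V.2.1‖}

/-- The Hessian quadratic form `(d²B(V) dV, dV)`. -/
noncomputable def hessianForm {E : Type*} [NormedAddCommGroup E] [NormedSpace ℝ E]
    (B : E → ℝ) (V dV : E) : ℝ :=
  fderiv ℝ (fderiv ℝ B) V dV dV

/-- `B` is smooth on the (not necessarily open) set `D`, as the restriction of a function that is
smooth on an open neighbourhood of `D`, so that its derivatives make sense at every point of `D`. -/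
def SmoothNear {E : Type*} [NormedAddCommGroup E] [NormedSpace ℝ E]
    (B : E → ℝ) (D : Set E) : Prop :=
  ∃ U : Set E, IsOpen U ∧ D ⊆ U ∧ ContDiffOn ℝ ∞ B U

/-! The domain need not be convex, so the one-leg inequality cannot be obtained by integrating a
Hessian bound along segments. Instead `bellman` is a sum of suprema, over frozen parameters, of
functions that are affine in `(x, y)` up to norms and involve the weights only through affine terms
and negative multiples of concave functions. For instance `|x|²/m = sup_p (2⟨p, x⟩ - |p|² m)`
(`norm_sq_div_eq`). Freezing the optimal parameters at `V₀`, and replacing `|x|`, `|y|` by their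
supporting linear functionals, gives `G ≤ B` with equality at `V₀`. Hence `dB = dG` there, and the
remainder of `B` is that of `G` plus `B - G` (`oneLeg_eq_add_sub_of_le`). The remainder of `G` comes
only from the concavity of the weight functions, which is estimated globally in the weights. This is
`le_oneLeg_bellman`.

Write `p = |x₀|/r₀`, `q = |y₀|/s₀`, let `ρ`, `σ` be the sizes of the weight increments, and split
the increments of `x`, `y` into parts of size `a`, `b` plus multiples of `x₀`, `y₀` of size `pρ`,
`qσ`. The product `ab` is paid for by `|x|²/r + |y|²/s`, and the mixed products also use `|x|²/m`,
`|y|²/n`, where `m` and `n` are `concaveWeight` at `(r, s)` and `(s, r)`. For `pρ · qσ` these still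
suffice unless `2|x₀| ≤ r₀|y₀|` and `2|y₀| ≤ s₀|x₀|` (the balanced case). There the third summand is
needed: a supremum over `(c, d)` with penalty `2kκ(c, d)`, where `k` is `coupling`, whose optimal
`c`, `d` are comparable to `p`, `q`.

The natural penalty `|cd|` is not smooth. Using `softAbs` makes the functional smooth while keeping
it strictly concave, so the implicit function theorem makes the supremum smooth
(`contDiffAt_pairSup`). The condition `|x|, |y| ≥ ℓ = 4δ` keeps the smoothing error harmless.

Near `V₀` the same remainder bound dominates a quadratic form, so it bounds the Hessian
(`le_hessianForm_of_le_oneLeg`). Comparing that form with a continuous `τ` gives the ellipse bound,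
and AM-GM then gives continuous convexity. -/

/-! ### A smooth substitute for the constrained quadratic supremum -/

/-- A smooth substitute for `|t|`. -/
noncomputable def softAbs (δ t : ℝ) : ℝ := √(t ^ 2 + δ ^ 2)

section SoftAbs

variable {δ : ℝ}

lemma softAbs_pos (hδ : 0 < δ) (t : ℝ) : 0 < softAbs δ t := by
  unfold softAbs; positivity

lemma softAbs_sq (δ t : ℝ) : softAbs δ t ^ 2 = t ^ 2 + δ ^ 2 := by
  unfold softAbs; exact Real.sq_sqrt (by positivity)

lemma softAbs_zero (hδ : 0 < δ) : softAbs δ 0 = δ := by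
  unfold softAbs; simp [hδ.le]

lemma abs_le_softAbs (hδ : 0 < δ) (t : ℝ) : |t| ≤ softAbs δ t := by
  refine abs_le_of_sq_le_sq ?_ (softAbs_pos hδ t).le
  rw [softAbs_sq]
  linarith [sq_nonneg δ]

lemma softAbs_le (hδ : 0 < δ) (t : ℝ) : softAbs δ t ≤ |t| + δ := by
  have h := softAbs_sq δ t
  have h2 := sq_abs t
  have := abs_nonneg t
  refine le_of_abs_le (abs_le_of_sq_le_sq ?_ (by positivity))
  nlinarith [mul_nonneg this hδ.le]

/-- Cauchy–Schwarz for the vectors `(|c|, δ)` and `(|d|, δ)`. It makes the penalty at least `|cd|`,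
and also yields the convexity of `softAbs`. -/
lemma abs_mul_le_softAbs_mul (hδ : 0 < δ) (c d : ℝ) :
    |c * d| + δ ^ 2 ≤ softAbs δ c * softAbs δ d := by
  have h1 := softAbs_sq δ c
  have h2 := softAbs_sq δ d
  refine le_of_abs_le (abs_le_of_sq_le_sq ?_ (mul_pos (softAbs_pos hδ c) (softAbs_pos hδ d)).le)
  rw [mul_pow, h1, h2, abs_mul]
  nlinarith [sq_nonneg (|c| - |d|), sq_abs c, sq_abs d, mul_nonneg (sq_nonneg δ)
    (sq_nonneg (|c| - |d|))]

lemma hasDerivAt_softAbs (hδ : 0 < δ) (t : ℝ) :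
    HasDerivAt (softAbs δ) (t / softAbs δ t) t := by
  unfold softAbs
  have h : HasDerivAt (fun t : ℝ => t ^ 2 + δ ^ 2) (2 * t) t := by
    simpa using (hasDerivAt_pow 2 t).add_const (δ ^ 2)
  convert! h.sqrt (by positivity) using 1
  field_simp

lemma contDiff_softAbs (hδ : 0 < δ) : ContDiff ℝ ∞ (softAbs δ) := by
  unfold softAbs
  exact ((contDiff_id.pow 2).add contDiff_const).sqrt (fun t => by positivity)

lemma softAbs_tangent_le (hδ : 0 < δ) (t u : ℝ) :
    softAbs δ t + t / softAbs δ t * (u - t) ≤ softAbs δ u := by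
  have hp := softAbs_pos hδ t
  have h := abs_mul_le_softAbs_mul hδ t u
  have h1 := softAbs_sq δ t
  have h2 := le_abs_self (t * u)
  rw [← mul_le_mul_iff_of_pos_left hp]
  have : softAbs δ t * (softAbs δ t + t / softAbs δ t * (u - t))
      = softAbs δ t ^ 2 + t * (u - t) := by field_simp
  rw [this]
  nlinarith

lemma abs_div_softAbs_le (hδ : 0 < δ) (t : ℝ) : |t / softAbs δ t| ≤ 1 := by
  rw [abs_div, abs_of_pos (softAbs_pos hδ t)]
  exact div_le_one_of_le₀ (abs_le_softAbs hδ t) (softAbs_pos hδ t).le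

lemma abs_softAbs_sub_le (hδ : 0 < δ) (t u : ℝ) : |softAbs δ u - softAbs δ t| ≤ |u - t| := by
  have h1 := softAbs_tangent_le hδ t u
  have h2 := softAbs_tangent_le hδ u t
  have h3 : ∀ v : ℝ, |v / softAbs δ v * (u - t)| ≤ |u - t| := fun v => by
    rw [abs_mul]
    exact mul_le_of_le_one_left (abs_nonneg _) (abs_div_softAbs_le hδ v)
  have h4 := abs_le.1 (h3 t)
  have h5 := abs_le.1 (h3 u)
  rw [abs_le]
  constructor <;> linarith

end SoftAbs

/-- The functional `2 c X + 2 d Y - c² r - d² s - 2 k κ(c, d)` of `z = (c, d)` with parameters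
`P = (X, Y, r, s, k)`, where `κ` is a smooth majorant of `|c d|` vanishing at the origin. -/
noncomputable def pairFunctional (δ : ℝ) (P : ℝ × ℝ × ℝ × ℝ × ℝ) (z : ℝ × ℝ) : ℝ :=
  2 * z.1 * P.1 + 2 * z.2 * P.2.1 - z.1 ^ 2 * P.2.2.1 - z.2 ^ 2 * P.2.2.2.1
    - 2 * P.2.2.2.2 * (softAbs δ z.1 * softAbs δ z.2 - δ ^ 2)

/-- Minus half of the gradient of `pairFunctional` in `z`. -/
noncomputable def pairGradient (δ : ℝ) (w : (ℝ × ℝ × ℝ × ℝ × ℝ) × ℝ × ℝ) : ℝ × ℝ :=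
  (w.1.2.2.1 * w.2.1 + w.1.2.2.2.2 * (w.2.1 / softAbs δ w.2.1 * softAbs δ w.2.2) - w.1.1,
    w.1.2.2.2.1 * w.2.2 + w.1.2.2.2.2 * (w.2.2 / softAbs δ w.2.2 * softAbs δ w.2.1) - w.1.2.1)

/-- The supremum of `pairFunctional` over `z`. -/
noncomputable def pairSup (δ : ℝ) (P : ℝ × ℝ × ℝ × ℝ × ℝ) : ℝ := ⨆ z, pairFunctional δ P z

/-- The parameters for which `pairFunctional` is strictly concave. -/
def Elliptic (P : ℝ × ℝ × ℝ × ℝ × ℝ) : Prop :=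
  0 < P.2.2.1 ∧ 0 < P.2.2.2.1 ∧ 0 < P.2.2.2.2 ∧ P.2.2.2.2 ^ 2 < P.2.2.1 * P.2.2.2.1

lemma isOpen_elliptic : IsOpen {P | Elliptic P} := by
  simp only [Elliptic, Set.ofPred_and]
  refine .inter ?_ (.inter ?_ (.inter ?_ ?_)) <;> exact isOpen_lt (by fun_prop) (by fun_prop)

/-! ### Strict concavity, attainment and smoothness of the supremum over `(c, d)`. -/

section PairSup

variable {δ : ℝ} {P : ℝ × ℝ × ℝ × ℝ × ℝ}

/-- The quadratic form controlling the concavity of `pairFunctional`. -/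
noncomputable def pairForm (P : ℝ × ℝ × ℝ × ℝ × ℝ) (z : ℝ × ℝ) : ℝ :=
  P.2.2.1 * z.1 ^ 2 + P.2.2.2.1 * z.2 ^ 2 - 2 * P.2.2.2.2 * (|z.1| * |z.2|)

lemma pairForm_pos (hP : Elliptic P) {z : ℝ × ℝ} (hz : z ≠ 0) : 0 < pairForm P z := by
  obtain ⟨X, Y, r, s, k⟩ := P
  obtain ⟨c, d⟩ := z
  obtain ⟨hr, hs, hk, hks⟩ := hP
  simp only [pairForm] at *
  have hc := abs_nonneg c
  have hd := abs_nonneg d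
  rw [← sq_abs c, ← sq_abs d]
  by_cases h : |d| = 0
  · have hc' : 0 < |c| := by
      refine abs_pos.2 fun h' => hz ?_
      simp [h', abs_eq_zero.1 h]
    rw [h]
    have : 0 < r * |c| ^ 2 := by positivity
    linarith
  · have hd' : 0 < |d| := lt_of_le_of_ne hd (Ne.symm h)
    have h1 : 0 < (r * s - k ^ 2) * |d| ^ 2 := mul_pos (by linarith) (by positivity)
    have h2 := sq_nonneg (r * |c| - k * |d|)
    have : 0 < r * (r * |c| ^ 2 + s * |d| ^ 2 - 2 * k * (|c| * |d|)) := by nlinarith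
    exact (mul_pos_iff_of_pos_left hr).1 this

lemma pairForm_nonneg (hP : Elliptic P) (z : ℝ × ℝ) : 0 ≤ pairForm P z := by
  by_cases h : z = 0
  · simp [h, pairForm]
  · exact (pairForm_pos hP h).le

/-- Expand `A'B'` about `AB`: convexity of `softAbs` bounds the first-order terms from below, and
its 1-Lipschitz property bounds the cross term by `-|c' - c||d' - d|`. The loss is absorbed by `r`
and `s` because `k² < rs`. No second derivatives are needed. -/
lemma pairFunctional_le (hδ : 0 < δ) (hP : Elliptic P) (z z' : ℝ × ℝ) :
    pairFunctional δ P z' ≤ pairFunctional δ P z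
      - 2 * ((pairGradient δ (P, z)).1 * (z'.1 - z.1) + (pairGradient δ (P, z)).2 * (z'.2 - z.2))
      - pairForm P (z' - z) := by
  obtain ⟨X, Y, r, s, k⟩ := P
  obtain ⟨c, d⟩ := z
  obtain ⟨c', d'⟩ := z'
  obtain ⟨hr, hs, hk, hks⟩ := hP
  simp only [pairForm, pairFunctional, pairGradient, Prod.fst_sub, Prod.snd_sub] at *
  have h1 := softAbs_tangent_le hδ c c'
  have h2 := softAbs_tangent_le hδ d d'
  have h3 := abs_softAbs_sub_le hδ c c'
  have h4 := abs_softAbs_sub_le hδ d d'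
  have hA := softAbs_pos hδ c
  have hB := softAbs_pos hδ d
  set A := softAbs δ c
  set B := softAbs δ d
  set A' := softAbs δ c'
  set B' := softAbs δ d'
  have h5 : -(|c' - c| * |d' - d|) ≤ (A' - A) * (B' - B) := by
    have : |(A' - A) * (B' - B)| ≤ |c' - c| * |d' - d| := by
      rw [abs_mul]; gcongr
    exact (abs_le.1 this).1
  have h6 := mul_le_mul_of_nonneg_right h1 hB.le
  have h7 := mul_le_mul_of_nonneg_right h2 hA.le
  have h8 : A * B + c / A * B * (c' - c) + d / B * A * (d' - d) - |c' - c| * |d' - d|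
      ≤ A' * B' := by nlinarith
  have h9 := mul_le_mul_of_nonneg_left h8 hk.le
  nlinarith

lemma pairGradient_mono (hδ : 0 < δ) (hP : Elliptic P) (z z' : ℝ × ℝ) :
    pairForm P (z' - z) ≤
      ((pairGradient δ (P, z')).1 - (pairGradient δ (P, z)).1) * (z'.1 - z.1) +
      ((pairGradient δ (P, z')).2 - (pairGradient δ (P, z)).2) * (z'.2 - z.2) := by
  have h1 := pairFunctional_le hδ hP z z'
  have h2 := pairFunctional_le hδ hP z' z
  have h3 : pairForm P (z - z') = pairForm P (z' - z) := by
    simp only [pairForm, Prod.fst_sub, Prod.snd_sub, abs_sub_comm z.1, abs_sub_comm z.2]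
    ring
  rw [h3] at h2
  nlinarith

lemma pairFunctional_le_of_pairGradient_eq_zero (hδ : 0 < δ) (hP : Elliptic P) {z : ℝ × ℝ}
    (hz : pairGradient δ (P, z) = 0) (z' : ℝ × ℝ) :
    pairFunctional δ P z' ≤ pairFunctional δ P z := by
  have h1 := pairFunctional_le hδ hP z z'
  have h2 := pairForm_nonneg hP (z' - z)
  simp only [hz, Prod.fst_zero, Prod.snd_zero] at h1
  linarith

lemma pairSup_eq (hδ : 0 < δ) (hP : Elliptic P) {z : ℝ × ℝ}
    (hz : pairGradient δ (P, z) = 0) : pairSup δ P = pairFunctional δ P z := by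
  have h : IsGreatest (Set.range (pairFunctional δ P)) (pairFunctional δ P z) :=
    ⟨⟨z, rfl⟩, by rintro _ ⟨z', rfl⟩; exact pairFunctional_le_of_pairGradient_eq_zero hδ hP hz z'⟩
  exact h.csSup_eq

lemma continuous_pairFunctional (hδ : 0 < δ) : Continuous (pairFunctional δ P) := by
  have := (contDiff_softAbs hδ).continuous
  unfold pairFunctional
  fun_prop

lemma pairFunctional_le_sq (hδ : 0 < δ) (hP : Elliptic P) (z : ℝ × ℝ) :
    pairFunctional δ P z ≤
      2 * z.1 * P.1 + 2 * z.2 * P.2.1 - z.1 ^ 2 * P.2.2.1 - z.2 ^ 2 * P.2.2.2.1 := by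
  have h1 := abs_mul_le_softAbs_mul hδ z.1 z.2
  have h2 := abs_nonneg (z.1 * z.2)
  have h3 : 0 ≤ P.2.2.2.2 * (softAbs δ z.1 * softAbs δ z.2 - δ ^ 2) :=
    mul_nonneg hP.2.2.1.le (by linarith)
  unfold pairFunctional
  linarith

lemma pairFunctional_le_div (hδ : 0 < δ) (hP : Elliptic P) (z : ℝ × ℝ) :
    pairFunctional δ P z ≤ P.1 ^ 2 / P.2.2.1 + P.2.1 ^ 2 / P.2.2.2.1 := by
  have h := pairFunctional_le_sq hδ hP z
  have h1 : ∀ c X r : ℝ, 0 < r → 2 * c * X - c ^ 2 * r ≤ X ^ 2 / r := fun c X r hr => by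
    rw [le_div_iff₀ hr]; nlinarith [sq_nonneg (X - c * r)]
  have h2 := h1 z.1 P.1 _ hP.1
  have h3 := h1 z.2 P.2.1 _ hP.2.1
  linarith

/-- The penalty is nonnegative, so discarding it leaves a coercive quadratic upper bound; a global
maximizer exists and both partial derivatives vanish there. -/
lemma exists_pairGradient_eq_zero (hδ : 0 < δ) (hP : Elliptic P) :
    ∃ z, pairGradient δ (P, z) = 0 := by
  obtain ⟨z, hz⟩ : ∃ z, ∀ z', pairFunctional δ P z' ≤ pairFunctional δ P z := by
    refine (continuous_pairFunctional hδ).exists_forall_ge' 0 ?_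
    have h0 : pairFunctional δ P 0 = 0 := by
      simp only [pairFunctional, Prod.fst_zero, Prod.snd_zero, softAbs_zero hδ]
      ring
    have hr := hP.1
    have hs := hP.2.1
    set μ := min P.2.2.1 P.2.2.2.1 with hμ
    have hμ0 : 0 < μ := lt_min hr hs
    set M := 2 * P.1 ^ 2 / P.2.2.1 + 2 * P.2.1 ^ 2 / P.2.2.2.1 with hM
    have hM0 : 0 ≤ M := by positivity
    filter_upwards [(tendsto_norm_cocompact_atTop (E := ℝ × ℝ)).eventually_ge_atTop
      (2 * M / μ + 1)] with z hz
    rw [h0]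
    refine (pairFunctional_le_sq hδ hP z).trans ?_
    have hyoung : ∀ c X r : ℝ, 0 < r → μ ≤ r →
        2 * c * X - c ^ 2 * r ≤ 2 * X ^ 2 / r - μ / 2 * c ^ 2 := fun c X r hr hμr => by
      have h1 : 2 * c * X - c ^ 2 * r / 2 ≤ 2 * X ^ 2 / r := by
        rw [le_div_iff₀ hr]; nlinarith [sq_nonneg (2 * X - c * r)]
      nlinarith [mul_le_mul_of_nonneg_right hμr (sq_nonneg c)]
    have h1 := hyoung z.1 P.1 _ hr (min_le_left _ _)
    have h2 := hyoung z.2 P.2.1 _ hs (min_le_right _ _)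
    have h3 : ‖z‖ ^ 2 ≤ z.1 ^ 2 + z.2 ^ 2 := by
      rcases max_choice ‖z.1‖ ‖z.2‖ with h | h <;>
        rw [Prod.norm_def, h, Real.norm_eq_abs, sq_abs] <;> nlinarith
    have hR : 1 ≤ 2 * M / μ + 1 := by
      have : 0 ≤ 2 * M / μ := by positivity
      linarith
    have h4 : 2 * M / μ + 1 ≤ ‖z‖ ^ 2 := by nlinarith
    have h5 : 2 * M ≤ μ * ‖z‖ ^ 2 := by
      have := (div_le_iff₀ hμ0).1 (show 2 * M / μ ≤ ‖z‖ ^ 2 by linarith)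
      linarith
    nlinarith [mul_le_mul_of_nonneg_left h3 hμ0.le]
  refine ⟨z, Prod.ext ?_ ?_⟩
  · have hmax : IsLocalMax (fun t => pairFunctional δ P (t, z.2)) z.1 :=
      Filter.Eventually.of_forall fun t => hz (t, z.2)
    have hd : HasDerivAt (fun t => pairFunctional δ P (t, z.2))
        (-2 * (pairGradient δ (P, z)).1) z.1 := by
      have h1 : HasDerivAt (fun t : ℝ => 2 * t * P.1) (2 * P.1) z.1 := by
        simpa using ((hasDerivAt_id z.1).const_mul 2).mul_const P.1
      have h2 : HasDerivAt (fun t : ℝ => t ^ 2 * P.2.2.1) (2 * z.1 * P.2.2.1) z.1 := by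
        simpa using (hasDerivAt_pow 2 z.1).mul_const P.2.2.1
      have h3 := ((((hasDerivAt_softAbs hδ z.1).mul_const (softAbs δ z.2)).sub_const
        (δ ^ 2)).const_mul (2 * P.2.2.2.2))
      convert! (((h1.add_const (2 * z.2 * P.2.1)).sub h2).sub_const
        (z.2 ^ 2 * P.2.2.2.1)).sub h3 using 1
      simp only [pairGradient]
      ring
    have := hmax.hasDerivAt_eq_zero hd
    simpa using this
  · have hmax : IsLocalMax (fun t => pairFunctional δ P (z.1, t)) z.2 :=
      Filter.Eventually.of_forall fun t => hz (z.1, t)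
    have hd : HasDerivAt (fun t => pairFunctional δ P (z.1, t))
        (-2 * (pairGradient δ (P, z)).2) z.2 := by
      have h1 : HasDerivAt (fun t : ℝ => 2 * t * P.2.1) (2 * P.2.1) z.2 := by
        simpa using ((hasDerivAt_id z.2).const_mul 2).mul_const P.2.1
      have h2 : HasDerivAt (fun t : ℝ => t ^ 2 * P.2.2.2.1) (2 * z.2 * P.2.2.2.1) z.2 := by
        simpa using (hasDerivAt_pow 2 z.2).mul_const P.2.2.2.1
      have h3 := ((((hasDerivAt_softAbs hδ z.2).const_mul (softAbs δ z.1)).sub_const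
        (δ ^ 2)).const_mul (2 * P.2.2.2.2))
      convert! (((h1.const_add (2 * z.1 * P.1)).sub_const
        (z.1 ^ 2 * P.2.2.1)).sub h2).sub h3 using 1
      simp only [pairGradient]
      ring
    have := hmax.hasDerivAt_eq_zero hd
    simpa using this

lemma exists_pairSup_eq (hδ : 0 < δ) (hP : Elliptic P) :
    ∃ z, pairGradient δ (P, z) = 0 ∧ pairSup δ P = pairFunctional δ P z := by
  obtain ⟨z, hz⟩ := exists_pairGradient_eq_zero hδ hP
  exact ⟨z, hz, pairSup_eq hδ hP hz⟩

lemma pairFunctional_le_pairSup (hδ : 0 < δ) (hP : Elliptic P) (z : ℝ × ℝ) :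
    pairFunctional δ P z ≤ pairSup δ P := by
  obtain ⟨z₀, hz, h⟩ := exists_pairSup_eq hδ hP
  rw [h]
  exact pairFunctional_le_of_pairGradient_eq_zero hδ hP hz z

lemma pairSup_nonneg (hδ : 0 < δ) (hP : Elliptic P) : 0 ≤ pairSup δ P := by
  refine le_trans (le_of_eq ?_) (pairFunctional_le_pairSup hδ hP 0)
  simp [pairFunctional, softAbs_zero hδ]
  right; ring

lemma pairSup_le (hδ : 0 < δ) (hP : Elliptic P) :
    pairSup δ P ≤ P.1 ^ 2 / P.2.2.1 + P.2.1 ^ 2 / P.2.2.2.1 :=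
  ciSup_le fun z => pairFunctional_le_div hδ hP z

lemma contDiff_pairFunctional (hδ : 0 < δ) :
    ContDiff ℝ ∞ (fun w : (ℝ × ℝ × ℝ × ℝ × ℝ) × ℝ × ℝ => pairFunctional δ w.1 w.2) := by
  have := contDiff_softAbs hδ
  unfold pairFunctional
  fun_prop

lemma contDiff_pairGradient (hδ : 0 < δ) : ContDiff ℝ ∞ (pairGradient δ) := by
  have h := contDiff_softAbs hδ
  have h1 : ContDiff ℝ ∞ (fun t => t / softAbs δ t) :=
    contDiff_id.div h fun t => (softAbs_pos hδ t).ne'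
  have h2 : ContDiff ℝ ∞ (fun w : (ℝ × ℝ × ℝ × ℝ × ℝ) × ℝ × ℝ => w.2.1 / softAbs δ w.2.1) :=
    h1.comp (f := fun w : (ℝ × ℝ × ℝ × ℝ × ℝ) × ℝ × ℝ => w.2.1) (by fun_prop)
  have h3 : ContDiff ℝ ∞ (fun w : (ℝ × ℝ × ℝ × ℝ × ℝ) × ℝ × ℝ => w.2.2 / softAbs δ w.2.2) :=
    h1.comp (f := fun w : (ℝ × ℝ × ℝ × ℝ × ℝ) × ℝ × ℝ => w.2.2) (by fun_prop)
  unfold pairGradient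
  fun_prop

/-- Passing to the limit in the monotonicity inequality gives `⟨T v, v⟩ ≥ pairForm P v > 0` for `v ≠
0`, so `T` is injective, hence invertible in finite dimension. -/
lemma isInvertible_fderiv_pairGradient (hδ : 0 < δ) (hP : Elliptic P) (z : ℝ × ℝ) :
    (fderiv ℝ (pairGradient δ) (P, z) ∘L
      .inr ℝ (ℝ × ℝ × ℝ × ℝ × ℝ) (ℝ × ℝ)).IsInvertible := by
  set T := fderiv ℝ (pairGradient δ) (P, z) ∘L .inr ℝ (ℝ × ℝ × ℝ × ℝ × ℝ) (ℝ × ℝ) with hT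
  have key : ∀ v : ℝ × ℝ, pairForm P v ≤ (T v).1 * v.1 + (T v).2 * v.2 := by
    intro v
    have hline : HasDerivAt (fun t : ℝ => ((P, z + t • v) : (ℝ × ℝ × ℝ × ℝ × ℝ) × ℝ × ℝ))
        (0, v) 0 := by
      refine (hasDerivAt_const _ _).prodMk ?_
      simpa using ((hasDerivAt_id (0 : ℝ)).smul_const v).const_add z
    have hG : HasDerivAt (fun t : ℝ => pairGradient δ (P, z + t • v)) (T v) 0 := by
      have h1 : HasFDerivAt (pairGradient δ) (fderiv ℝ (pairGradient δ) (P, z))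
          (P, z + (0 : ℝ) • v) := by
        simpa using ((contDiff_pairGradient hδ).differentiable (by simp) (P, z)).hasFDerivAt
      exact h1.comp_hasDerivAt (0 : ℝ) hline
    have hfst : HasDerivAt (fun t : ℝ => (pairGradient δ (P, z + t • v)).1) (T v).1 0 :=
      (ContinuousLinearMap.fst ℝ ℝ ℝ).hasFDerivAt.comp_hasDerivAt (0 : ℝ) hG
    have hsnd : HasDerivAt (fun t : ℝ => (pairGradient δ (P, z + t • v)).2) (T v).2 0 :=
      (ContinuousLinearMap.snd ℝ ℝ ℝ).hasFDerivAt.comp_hasDerivAt (0 : ℝ) hG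
    have hg := (hfst.mul_const v.1).add (hsnd.mul_const v.2)
    refine ge_of_tendsto hg.tendsto_slope_zero_right ?_
    filter_upwards [self_mem_nhdsWithin] with t ht
    have ht : 0 < t := ht
    have hmono := pairGradient_mono hδ hP z (z + t • v)
    have hform : pairForm P (z + t • v - z) = t ^ 2 * pairForm P v := by
      simp only [pairForm, add_sub_cancel_left, Prod.smul_fst, Prod.smul_snd, smul_eq_mul,
        abs_mul, abs_of_pos ht]
      ring
    rw [hform] at hmono
    simp only [Prod.fst_add, Prod.snd_add, Prod.smul_fst, Prod.smul_snd, smul_eq_mul,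
      add_sub_cancel_left] at hmono
    simp only [Pi.add_apply, zero_add, zero_smul, add_zero, smul_eq_mul]
    rw [inv_mul_eq_div, le_div_iff₀ ht]
    refine le_of_mul_le_mul_left ?_ ht
    linarith
  have hinj : Function.Injective (T : ℝ × ℝ →ₗ[ℝ] ℝ × ℝ) := by
    refine (injective_iff_map_eq_zero _).2 fun v hv => ?_
    by_contra hne
    have h1 := key v
    have h2 := pairForm_pos hP hne
    rw [show T v = 0 from hv] at h1
    simp at h1
    linarith
  exact ⟨(LinearEquiv.ofInjectiveEndo _ hinj).toContinuousLinearEquiv, by ext <;> rfl⟩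

/-- The implicit function theorem gives a smooth branch of critical points. By concavity every
critical point is a maximizer, so the supremum is the functional along that branch. -/
lemma contDiffAt_pairSup (hδ : 0 < δ) (hP : Elliptic P) : ContDiffAt ℝ ∞ (pairSup δ) P := by
  obtain ⟨z, hz⟩ := exists_pairGradient_eq_zero hδ hP
  have cdf : ContDiffAt ℝ ∞ (pairGradient δ) (P, z) := (contDiff_pairGradient hδ).contDiffAt
  have hinv := isInvertible_fderiv_pairGradient hδ hP z
  have hpn : (∞ : WithTop ℕ∞) ≠ 0 := by simp
  set ψ := cdf.implicitFunction hpn hinv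
  have h1 : ContDiffAt ℝ ∞ ψ P := cdf.contDiffAt_implicitFunction hpn hinv
  have h2 : ∀ᶠ P' in nhds P, pairGradient δ (P', ψ P') = 0 := by
    have := cdf.eventually_apply_implicitFunction hpn hinv
    rwa [hz] at this
  have h3 : ContDiffAt ℝ ∞ (fun P' => pairFunctional δ P' (ψ P')) P :=
    (contDiff_pairFunctional hδ).contDiffAt.comp P (contDiffAt_id.prodMk h1)
  refine h3.congr_of_eventuallyEq ?_
  filter_upwards [h2, isOpen_elliptic.mem_nhds hP] with P' h4 h5
  exact pairSup_eq hδ h5 h4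

end PairSup

/-! ### First-order Taylor remainders -/

/-- The remainder of the first-order Taylor expansion of `f` at `V₀`. -/
noncomputable def oneLeg {E : Type*} [NormedAddCommGroup E] [NormedSpace ℝ E]
    (f : E → ℝ) (V₀ V : E) : ℝ :=
  f V - f V₀ - fderiv ℝ f V₀ (V - V₀)

section OneLeg

variable {E F : Type*} [NormedAddCommGroup E] [NormedSpace ℝ E] [NormedAddCommGroup F]
  [NormedSpace ℝ F] {f g : E → ℝ} {V₀ : E}

/-- A function touching `f` from below has the same derivative at the contact point, since the
difference has a local minimum there. -/
lemma oneLeg_eq_add_sub_of_le (hf : DifferentiableAt ℝ f V₀) (hg : DifferentiableAt ℝ g V₀)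
    (hle : ∀ᶠ V in nhds V₀, g V ≤ f V) (heq : g V₀ = f V₀) (V : E) :
    oneLeg f V₀ V = oneLeg g V₀ V + (f V - g V) := by
  have hmin : IsLocalMin (fun V => f V - g V) V₀ := by
    filter_upwards [hle] with V hV
    rw [heq]
    linarith
  have h := hmin.fderiv_eq_zero
  rw [fderiv_fun_sub hf hg, sub_eq_zero] at h
  simp only [oneLeg, h, heq]
  ring

lemma oneLeg_clm_add (L : E →L[ℝ] ℝ) (hg : DifferentiableAt ℝ g V₀) (V : E) :
    oneLeg (fun V => L V + g V) V₀ V = oneLeg g V₀ V := by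
  simp only [oneLeg]
  rw [fderiv_fun_add L.differentiableAt hg]
  simp only [ContinuousLinearMap.fderiv, add_apply, map_sub]
  ring

lemma oneLeg_add (hf : DifferentiableAt ℝ f V₀) (hg : DifferentiableAt ℝ g V₀) (V : E) :
    oneLeg (fun V => f V + g V) V₀ V = oneLeg f V₀ V + oneLeg g V₀ V := by
  simp only [oneLeg]
  rw [fderiv_fun_add hf hg]
  simp only [add_apply]
  ring

lemma oneLeg_const_mul (a : ℝ) (hf : DifferentiableAt ℝ f V₀) (V : E) :
    oneLeg (fun V => a * f V) V₀ V = a * oneLeg f V₀ V := by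
  simp only [oneLeg]
  rw [fderiv_const_mul hf]
  simp only [smul_apply, smul_eq_mul]
  ring

lemma oneLeg_comp_clm (L : F →L[ℝ] E) {W₀ : F} (hf : DifferentiableAt ℝ f (L W₀)) (W : F) :
    oneLeg (fun W => f (L W)) W₀ W = oneLeg f (L W₀) (L W) := by
  have h : HasFDerivAt (fun W => f (L W)) ((fderiv ℝ f (L W₀)).comp L) W₀ :=
    hf.hasFDerivAt.comp W₀ L.hasFDerivAt
  simp only [oneLeg, h.fderiv, ContinuousLinearMap.comp_apply, map_sub]

/-- A local quadratic lower bound for the Taylor remainder bounds the Hessian from below. -/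
lemma le_hessianForm_of_le_oneLeg (hf : ContDiffAt ℝ ∞ f V₀) (q : E → ℝ)
    (hq : ∀ (t : ℝ) v, q (t • v) = t ^ 2 * q v)
    (hle : ∀ᶠ V in nhds V₀, q (V - V₀) ≤ oneLeg f V₀ V) (v : E) :
    2 * q v ≤ hessianForm f V₀ v := by
  have hline : ∀ t : ℝ, HasDerivAt (fun t : ℝ => V₀ + t • v) v t := fun t => by
    simpa using ((hasDerivAt_id t).smul_const v).const_add V₀
  have hcont : Filter.Tendsto (fun t : ℝ => V₀ + t • v) (nhds 0) (nhds V₀) := by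
    simpa using (hline 0).continuousAt.tendsto
  set h : ℝ → ℝ := fun t => f (V₀ + t • v) - f V₀ - t * fderiv ℝ f V₀ v - t ^ 2 * q v with hh
  set h' : ℝ → ℝ := fun t => fderiv ℝ f (V₀ + t • v) v - fderiv ℝ f V₀ v - 2 * t * q v with hh'
  have hd : ∀ᶠ t in nhds (0 : ℝ), HasDerivAt h (h' t) t := by
    have h1 : ∀ᶠ V in nhds V₀, DifferentiableAt ℝ f V := by
      filter_upwards [(hf.of_le (m := 1) (by norm_cast)).eventually (by simp)] with V hV
      exact hV.differentiableAt (by simp)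
    filter_upwards [hcont.eventually h1] with t ht
    have h2 : HasDerivAt (fun t : ℝ => f (V₀ + t • v)) (fderiv ℝ f (V₀ + t • v) v) t :=
      ht.hasFDerivAt.comp_hasDerivAt t (hline t)
    have h3 : HasDerivAt (fun t : ℝ => t * fderiv ℝ f V₀ v) (fderiv ℝ f V₀ v) t := by
      simpa using (hasDerivAt_id t).mul_const (fderiv ℝ f V₀ v)
    have h4 : HasDerivAt (fun t : ℝ => t ^ 2 * q v) (2 * t * q v) t := by
      simpa using (hasDerivAt_pow 2 t).mul_const (q v)
    exact ((h2.sub_const _).sub h3).sub h4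
  have hdd : HasDerivAt h' (hessianForm f V₀ v - 2 * q v) 0 := by
    have h1 : DifferentiableAt ℝ (fderiv ℝ f) V₀ :=
      (hf.fderiv_right (m := 1) (by norm_cast)).differentiableAt (by simp)
    have h2 : HasFDerivAt (fderiv ℝ f) (fderiv ℝ (fderiv ℝ f) V₀) (V₀ + (0 : ℝ) • v) := by
      simpa using h1.hasFDerivAt
    have h3 : HasDerivAt (fun t : ℝ => fderiv ℝ f (V₀ + t • v) v)
        (fderiv ℝ (fderiv ℝ f) V₀ v v) 0 := by
      have h3' : HasDerivAt (fun t : ℝ => fderiv ℝ f (V₀ + t • v))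
          (fderiv ℝ (fderiv ℝ f) V₀ v) 0 := h2.comp_hasDerivAt (0 : ℝ) (hline 0)
      exact (ContinuousLinearMap.apply ℝ ℝ v).hasFDerivAt.comp_hasDerivAt (0 : ℝ) h3'
    have h4 : HasDerivAt (fun t : ℝ => 2 * t * q v) (2 * q v) 0 := by
      simpa using ((hasDerivAt_id (0 : ℝ)).const_mul 2).mul_const (q v)
    exact (h3.sub_const _).sub h4
  have hderiv : deriv h =ᶠ[nhds 0] h' := hd.mono fun t ht => ht.deriv
  have hsecond : deriv (deriv h) 0 = hessianForm f V₀ v - 2 * q v := by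
    rw [hderiv.deriv_eq, hdd.deriv]
  have hnonneg : ∀ᶠ t in nhds (0 : ℝ), 0 ≤ h t := by
    filter_upwards [hcont.eventually hle] with t ht
    simp only [oneLeg, add_sub_cancel_left, hq, map_smul, smul_eq_mul] at ht
    simp only [hh]
    linarith
  -- Second derivative test: `h''(0) < 0` would make `0` a local maximum of `h`, and `h ≥ 0 = h(0)`
  -- would then force `h` to vanish near `0`, so `h''(0) = 0`.
  by_contra hlt
  have hneg : deriv (deriv h) 0 < 0 := by rw [hsecond]; linarith
  have hmax : IsLocalMax h 0 := isLocalMax_of_deriv_deriv_neg hneg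
    (by rw [hderiv.eq_of_nhds]; simp [hh']) hd.self_of_nhds.continuousAt
  have hzero : h =ᶠ[nhds 0] fun _ => 0 := by
    filter_upwards [hnonneg, hmax] with t h1 h2
    have : h 0 = 0 := by simp [hh]
    linarith
  have : deriv (deriv h) 0 = 0 := by
    rw [hzero.deriv.deriv_eq]; simp
  linarith

end OneLeg

/-! ### Concave functions of the weights -/

/-- A function of `w = (r, s)` comparable to `r` and strictly concave where `1 ≤ r s ≤ Q`. -/
noncomputable def concaveWeight (Q : ℝ) (w : ℝ × ℝ) : ℝ :=
  6 * w.1 - 3 / w.2 - w.1 ^ 2 * w.2 / Q ^ 2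

/-- A bounded function of `w = (r, s)`, strictly concave where `r s ≤ Q`. -/
noncomputable def coupling (Q : ℝ) (w : ℝ × ℝ) : ℝ :=
  √(w.1 * w.2 / Q) - w.1 * w.2 / (8 * Q)

section Weights

variable {Q : ℝ} {w₀ w : ℝ × ℝ}

lemma contDiffAt_concaveWeight (hs : w.2 ≠ 0) : ContDiffAt ℝ ∞ (concaveWeight Q) w := by
  unfold concaveWeight
  fun_prop (disch := assumption)

lemma contDiffAt_coupling (hQ : 0 < Q) (hr : 0 < w.1) (hs : 0 < w.2) :
    ContDiffAt ℝ ∞ (coupling Q) w := by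
  have h : ContDiffAt ℝ ∞ (fun w : ℝ × ℝ => √(w.1 * w.2 / Q)) w :=
    ContDiffAt.sqrt (by fun_prop) (by positivity)
  unfold coupling
  fun_prop

lemma neg_oneLeg_concaveWeight (hs₀ : 0 < w₀.2) (hs : 0 < w.2) :
    -oneLeg (concaveWeight Q) w₀ w = 3 * (w.2 - w₀.2) ^ 2 / (w.2 * w₀.2 ^ 2)
      + (w.2 * (w.1 - w₀.1) ^ 2 + 2 * w₀.1 * (w.1 - w₀.1) * (w.2 - w₀.2)) / Q ^ 2 := by
  have hfst : HasFDerivAt (fun w : ℝ × ℝ => w.1) (ContinuousLinearMap.fst ℝ ℝ ℝ) w₀ :=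
    hasFDerivAt_fst
  have hsnd : HasFDerivAt (fun w : ℝ × ℝ => w.2) (ContinuousLinearMap.snd ℝ ℝ ℝ) w₀ :=
    hasFDerivAt_snd
  have h := ((hfst.const_mul 6).sub (((hasDerivAt_inv hs₀.ne').comp_hasFDerivAt w₀ hsnd).const_mul
    3)).sub (((hfst.pow 2).mul hsnd).mul_const (Q ^ 2)⁻¹)
  have h' : HasFDerivAt (concaveWeight Q) _ w₀ := h
  simp only [oneLeg, h'.fderiv]
  simp only [concaveWeight, sub_apply, smul_apply,
    add_apply, ContinuousLinearMap.coe_fst', ContinuousLinearMap.coe_snd',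
    Prod.fst_sub, Prod.snd_sub, smul_eq_mul]
  simp
  field_simp
  ring

/-- Complete the square in the mixed term `2 r₀ a b / Q²`. This costs half of the `a²` term and at
most two of the three units of `b²/(s s₀²)`, because `r₀ s₀ ≤ Q`. -/
lemma le_neg_oneLeg_concaveWeight (hQ : 0 < Q) (hr₀ : 0 < w₀.1) (hs₀ : 0 < w₀.2)
    (hw₀ : w₀.1 * w₀.2 ≤ Q) (hs : 0 < w.2) :
    w.2 * (w.1 - w₀.1) ^ 2 / (2 * Q ^ 2) + (w.2 - w₀.2) ^ 2 / (w.2 * w₀.2 ^ 2)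
      ≤ -oneLeg (concaveWeight Q) w₀ w := by
  rw [neg_oneLeg_concaveWeight hs₀ hs]
  obtain ⟨r₀, s₀⟩ := w₀
  obtain ⟨r, s⟩ := w
  dsimp only at *
  set a := r - r₀
  set b := s - s₀
  have h1 : 0 ≤ (s * a + 2 * r₀ * b) ^ 2 / (2 * s * Q ^ 2) := by positivity
  have h2 : 0 ≤ 2 * b ^ 2 * (Q ^ 2 - (r₀ * s₀) ^ 2) / (s * s₀ ^ 2 * Q ^ 2) := by
    have : (r₀ * s₀) ^ 2 ≤ Q ^ 2 := by gcongr
    have : 0 ≤ Q ^ 2 - (r₀ * s₀) ^ 2 := by linarith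
    positivity
  have h3 : 3 * b ^ 2 / (s * s₀ ^ 2) + (s * a ^ 2 + 2 * r₀ * a * b) / Q ^ 2
      = s * a ^ 2 / (2 * Q ^ 2) + b ^ 2 / (s * s₀ ^ 2) + (s * a + 2 * r₀ * b) ^ 2 / (2 * s * Q ^ 2)
        + 2 * b ^ 2 * (Q ^ 2 - (r₀ * s₀) ^ 2) / (s * s₀ ^ 2 * Q ^ 2) := by
    field_simp
    ring
  linarith

/-- The Taylor remainder of `coupling` in terms of `α² = r / r₀` and `β² = s / s₀`. -/
lemma neg_oneLeg_coupling (hQ : 0 < Q) (hr₀ : 0 < w₀.1) (hs₀ : 0 < w₀.2) (hr : 0 < w.1)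
    (hs : 0 < w.2) :
    -oneLeg (coupling Q) w₀ w = √(w₀.1 * w₀.2 / Q) / 2 * (√(w.1 / w₀.1) - √(w.2 / w₀.2)) ^ 2
      + (w.1 - w₀.1) * (w.2 - w₀.2) / (8 * Q) := by
  have hfst : HasFDerivAt (fun w : ℝ × ℝ => w.1) (ContinuousLinearMap.fst ℝ ℝ ℝ) w₀ :=
    hasFDerivAt_fst
  have hsnd : HasFDerivAt (fun w : ℝ × ℝ => w.2) (ContinuousLinearMap.snd ℝ ℝ ℝ) w₀ :=
    hasFDerivAt_snd
  have hpos : 0 < w₀.1 * w₀.2 * Q⁻¹ := by positivity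
  have h := (((hfst.mul hsnd).mul_const Q⁻¹).sqrt hpos.ne').sub
    ((hfst.mul hsnd).mul_const (8 * Q)⁻¹)
  have h' : HasFDerivAt (coupling Q) _ w₀ := h
  simp only [oneLeg, h'.fderiv]
  simp only [coupling, sub_apply, smul_apply,
    add_apply, ContinuousLinearMap.coe_fst', ContinuousLinearMap.coe_snd',
    Prod.fst_sub, Prod.snd_sub, smul_eq_mul, Pi.mul_apply, ← div_eq_mul_inv]
  have e1 : √(w.1 * w.2 / Q) = √(w₀.1 * w₀.2 / Q) * √(w.1 / w₀.1) * √(w.2 / w₀.2) := by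
    rw [← Real.sqrt_mul (by positivity), ← Real.sqrt_mul (by positivity)]
    congr 1
    field_simp
  have e2 : √(w.1 / w₀.1) ^ 2 = w.1 / w₀.1 := Real.sq_sqrt (by positivity)
  have e3 : √(w.2 / w₀.2) ^ 2 = w.2 / w₀.2 := Real.sq_sqrt (by positivity)
  have e4 : √(w₀.1 * w₀.2 / Q) ^ 2 = w₀.1 * w₀.2 / Q := Real.sq_sqrt (by positivity)
  have e5 : 0 < √(w₀.1 * w₀.2 / Q) := by positivity
  rw [e1, sub_sq, e2, e3]
  set θ := √(w₀.1 * w₀.2 / Q)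
  -- Eliminating `Q` in favour of `θ` turns the claim into an identity of rational expressions.
  have e6 : Q = w₀.1 * w₀.2 / θ ^ 2 := by rw [e4]; field_simp
  clear_value θ
  rw [e6]
  field_simp
  ring

lemma sqrt_div_le_one (hQ : 0 < Q) (hw₀ : w₀.1 * w₀.2 ≤ Q) : √(w₀.1 * w₀.2 / Q) ≤ 1 := by
  exact Real.sqrt_le_one.2 (div_le_one_of_le₀ hw₀ hQ.le)

lemma div_le_sqrt_div (hQ : 0 < Q) (hr₀ : 0 < w₀.1) (hs₀ : 0 < w₀.2) (hw₀ : w₀.1 * w₀.2 ≤ Q) :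
    w₀.1 * w₀.2 / Q ≤ √(w₀.1 * w₀.2 / Q) := by
  have h1 := sqrt_div_le_one hQ hw₀
  have h2 : √(w₀.1 * w₀.2 / Q) ^ 2 = w₀.1 * w₀.2 / Q := Real.sq_sqrt (by positivity)
  have h3 := Real.sqrt_nonneg (w₀.1 * w₀.2 / Q)
  nlinarith

/-- The geometric mean is degenerate in the radial direction, where the term `-rs/(8Q)` is concave.
When the increments have opposite signs that term is adverse, but the geometric mean dominates it,
by `(α - β)² + (α² - 1)(β² - 1) = (1 - αβ)²`. -/
lemma le_neg_oneLeg_coupling (hQ : 0 < Q) (hr₀ : 0 < w₀.1) (hs₀ : 0 < w₀.2)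
    (hw₀ : w₀.1 * w₀.2 ≤ Q) (hr : 0 < w.1) (hs : 0 < w.2) :
    |w.1 - w₀.1| * |w.2 - w₀.2| / (8 * Q) ≤ -oneLeg (coupling Q) w₀ w := by
  rw [neg_oneLeg_coupling hQ hr₀ hs₀ hr hs, ← abs_mul]
  have hθ := div_le_sqrt_div hQ hr₀ hs₀ hw₀
  set α := √(w.1 / w₀.1)
  set β := √(w.2 / w₀.2)
  have e2 : α ^ 2 = w.1 / w₀.1 := Real.sq_sqrt (by positivity)
  have e3 : β ^ 2 = w.2 / w₀.2 := Real.sq_sqrt (by positivity)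
  have e4 : (w.1 - w₀.1) * (w.2 - w₀.2) / Q = w₀.1 * w₀.2 / Q * ((α ^ 2 - 1) * (β ^ 2 - 1)) := by
    rw [e2, e3]; field_simp
  have e5 : -((α ^ 2 - 1) * (β ^ 2 - 1)) ≤ (α - β) ^ 2 := by
    nlinarith [sq_nonneg (1 - α * β)]
  have h0 : 0 ≤ w₀.1 * w₀.2 / Q := by positivity
  have h1 : -((w.1 - w₀.1) * (w.2 - w₀.2) / Q) ≤ √(w₀.1 * w₀.2 / Q) * (α - β) ^ 2 := by
    rw [e4]
    calc _ = w₀.1 * w₀.2 / Q * (-((α ^ 2 - 1) * (β ^ 2 - 1))) := by ring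
      _ ≤ w₀.1 * w₀.2 / Q * (α - β) ^ 2 := by gcongr
      _ ≤ _ := by gcongr
  have h2 : 0 ≤ √(w₀.1 * w₀.2 / Q) * (α - β) ^ 2 := by positivity
  set D := (w.1 - w₀.1) * (w.2 - w₀.2)
  have h3 : |D| / (8 * Q) = |D / Q| / 8 := by rw [abs_div, abs_of_pos hQ]; field_simp
  have h4 : D / (8 * Q) = D / Q / 8 := by field_simp
  rw [h3, h4]
  rcases abs_cases (D / Q) with ⟨h, _⟩ | ⟨h, _⟩ <;> rw [h] <;> linarith

/-- With the weights at most doubled, `α + β` is bounded, so `(α - β)²` controls `(a - b)²`. The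
cross terms of `(a - b)²/16 + ab/8` then cancel, leaving both squares. -/
lemma le_neg_oneLeg_coupling_of_le (hQ : 0 < Q) (hr₀ : 0 < w₀.1) (hs₀ : 0 < w₀.2)
    (hw₀ : w₀.1 * w₀.2 ≤ Q) (hr : 0 < w.1) (hs : 0 < w.2) (hr2 : w.1 ≤ 2 * w₀.1)
    (hs2 : w.2 ≤ 2 * w₀.2) :
    (w₀.2 / w₀.1 * (w.1 - w₀.1) ^ 2 + w₀.1 / w₀.2 * (w.2 - w₀.2) ^ 2) / (24 * Q)
      ≤ -oneLeg (coupling Q) w₀ w := by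
  rw [neg_oneLeg_coupling hQ hr₀ hs₀ hr hs]
  have hθ := div_le_sqrt_div hQ hr₀ hs₀ hw₀
  set α := √(w.1 / w₀.1)
  set β := √(w.2 / w₀.2)
  have e2 : α ^ 2 = w.1 / w₀.1 := Real.sq_sqrt (by positivity)
  have e3 : β ^ 2 = w.2 / w₀.2 := Real.sq_sqrt (by positivity)
  have hα : 0 ≤ α := Real.sqrt_nonneg _
  have hβ : 0 ≤ β := Real.sqrt_nonneg _
  have hα2 : α ^ 2 ≤ 2 := by rw [e2]; exact (div_le_iff₀ hr₀).2 hr2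
  have hβ2 : β ^ 2 ≤ 2 := by rw [e3]; exact (div_le_iff₀ hs₀).2 hs2
  have h0 : 0 ≤ w₀.1 * w₀.2 / Q := by positivity
  set a := α ^ 2 - 1 with ha
  set b := β ^ 2 - 1 with hb
  have e4 : (w.1 - w₀.1) * (w.2 - w₀.2) / (8 * Q) = w₀.1 * w₀.2 / Q * (a * b / 8) := by
    rw [ha, hb, e2, e3]; field_simp
  have e5 : (w₀.2 / w₀.1 * (w.1 - w₀.1) ^ 2 + w₀.1 / w₀.2 * (w.2 - w₀.2) ^ 2) / (24 * Q)
      = w₀.1 * w₀.2 / Q * ((a ^ 2 + b ^ 2) / 24) := by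
    rw [ha, hb, e2, e3]; field_simp
  have h1 : (a - b) ^ 2 ≤ 8 * (α - β) ^ 2 := by
    have : (α + β) ^ 2 ≤ 8 := by nlinarith [sq_nonneg (α - β)]
    calc (a - b) ^ 2 = (α + β) ^ 2 * (α - β) ^ 2 := by rw [ha, hb]; ring
      _ ≤ _ := by gcongr
  have h2 : w₀.1 * w₀.2 / Q * (a - b) ^ 2 / 16 ≤ √(w₀.1 * w₀.2 / Q) / 2 * (α - β) ^ 2 := by
    have : w₀.1 * w₀.2 / Q * (a - b) ^ 2 ≤ √(w₀.1 * w₀.2 / Q) * (8 * (α - β) ^ 2) := by gcongr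
    linarith
  have h3 : (a ^ 2 + b ^ 2) / 24 ≤ (a - b) ^ 2 / 16 + a * b / 8 := by nlinarith
  have h4 := mul_le_mul_of_nonneg_left h3 h0
  rw [e4, e5]
  linarith

lemma two_mul_le_concaveWeight (hQ : 1 ≤ Q) (hr : 0 < w.1) (hs : 0 < w.2) (h1 : 1 ≤ w.1 * w.2)
    (h2 : w.1 * w.2 ≤ Q) : 2 * w.1 ≤ concaveWeight Q w := by
  unfold concaveWeight
  have h3 : 3 / w.2 ≤ 3 * w.1 := by rw [div_le_iff₀ hs]; linarith
  have h4 : w.1 ^ 2 * w.2 / Q ^ 2 ≤ w.1 := by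
    rw [div_le_iff₀ (by positivity)]
    have : w.1 * w.2 ≤ Q ^ 2 := by nlinarith
    nlinarith
  linarith

lemma concaveWeight_le (hr : 0 < w.1) (hs : 0 < w.2) : concaveWeight Q w ≤ 6 * w.1 := by
  unfold concaveWeight
  have h3 : 0 ≤ 3 / w.2 := by positivity
  have h4 : 0 ≤ w.1 ^ 2 * w.2 / Q ^ 2 := by positivity
  linarith

/-- The bounds `3/4` and `2Q` are what an open neighbourhood of `1 ≤ rs ≤ Q` can afford: the
subtracted terms are below `4r` and at most `2r`. -/
lemma concaveWeight_pos (hQ : 1 ≤ Q) (hr : 0 < w.1) (hs : 0 < w.2) (h1 : 3 / 4 < w.1 * w.2)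
    (h2 : w.1 * w.2 < 2 * Q) : 0 < concaveWeight Q w := by
  unfold concaveWeight
  have h3 : 3 / w.2 < 4 * w.1 := by rw [div_lt_iff₀ hs]; linarith
  have h4 : w.1 ^ 2 * w.2 / Q ^ 2 ≤ 2 * w.1 := by
    rw [div_le_iff₀ (by positivity)]
    have : w.1 * w.2 ≤ 2 * Q ^ 2 := by nlinarith
    nlinarith
  linarith

lemma coupling_pos (hQ : 0 < Q) (hr : 0 < w.1) (hs : 0 < w.2) (h2 : w.1 * w.2 < 2 * Q) :
    0 < coupling Q w := by
  have e4 : √(w.1 * w.2 / Q) ^ 2 = w.1 * w.2 / Q := Real.sq_sqrt (by positivity)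
  have e5 : 0 < √(w.1 * w.2 / Q) := by positivity
  have e6 : w.1 * w.2 / Q < 2 := by rwa [div_lt_iff₀ hQ]
  have e7 : w.1 * w.2 / (8 * Q) = √(w.1 * w.2 / Q) ^ 2 / 8 := by rw [e4]; field_simp
  unfold coupling
  rw [e7]
  nlinarith

lemma coupling_lt (hQ : 0 < Q) (hr : 0 < w.1) (hs : 0 < w.2) :
    coupling Q w < √(w.1 * w.2 / Q) := by
  have : 0 < w.1 * w.2 / (8 * Q) := by positivity
  unfold coupling
  linarith

lemma coupling_sq_lt (hQ : 1 ≤ Q) (hr : 0 < w.1) (hs : 0 < w.2) (h2 : w.1 * w.2 < 2 * Q) :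
    coupling Q w ^ 2 < w.1 * w.2 := by
  have hQ0 : 0 < Q := by linarith
  calc coupling Q w ^ 2 < √(w.1 * w.2 / Q) ^ 2 := by
        have := coupling_lt hQ0 hr hs
        have := coupling_pos hQ0 hr hs h2
        gcongr
    _ = w.1 * w.2 / Q := Real.sq_sqrt (by positivity)
    _ ≤ w.1 * w.2 := div_le_self (by positivity) hQ

end Weights

/-! ### The Bellman function -/

/-- The Bellman function of `V = (x, y, r, s)`. -/
noncomputable def bellman {H : Type*} [NormedAddCommGroup H] (Q δ : ℝ) (V : H × H × ℝ × ℝ) : ℝ :=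
  100 * (‖V.1‖ ^ 2 / V.2.2.1 + ‖V.2.1‖ ^ 2 / V.2.2.2)
    + 3600 * (‖V.1‖ ^ 2 / concaveWeight Q V.2.2 + ‖V.2.1‖ ^ 2 / concaveWeight Q V.2.2.swap)
    + 6400 * pairSup δ (‖V.1‖, ‖V.2.1‖, V.2.2.1, V.2.2.2, coupling Q V.2.2)

/-- An open set on which the Bellman function is smooth. -/
def bellmanDomain (H : Type*) [NormedAddCommGroup H] (Q : ℝ) : Set (H × H × ℝ × ℝ) :=
  {V | V.1 ≠ 0 ∧ V.2.1 ≠ 0 ∧ 0 < V.2.2.1 ∧ 0 < V.2.2.2 ∧ 3 / 4 < V.2.2.1 * V.2.2.2 ∧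
    V.2.2.1 * V.2.2.2 < 2 * Q}

section Bellman

variable {H : Type*} [NormedAddCommGroup H] {Q δ ε ℓ : ℝ} {V V₀ : H × H × ℝ × ℝ}

lemma isOpen_bellmanDomain : IsOpen (bellmanDomain H Q) := by
  simp only [bellmanDomain, Set.ofPred_and]
  refine .inter ?_ (.inter ?_ (.inter ?_ (.inter ?_ (.inter ?_ ?_))))
  · exact isOpen_ne_fun (by fun_prop) (by fun_prop)
  · exact isOpen_ne_fun (by fun_prop) (by fun_prop)
  all_goals exact isOpen_lt (by fun_prop) (by fun_prop)

lemma truncatedDomain_subset_bellmanDomain (hQ : 1 ≤ Q) (hℓ : 0 < ℓ) :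
    truncatedDomain H Q ε ℓ ⊆ bellmanDomain H Q := by
  rintro V ⟨⟨⟨hr, hs, h1, h2⟩, -⟩, hx, hy⟩
  exact ⟨norm_pos_iff.1 (hℓ.trans_le hx), norm_pos_iff.1 (hℓ.trans_le hy), hr, hs, by linarith,
    by linarith⟩

lemma elliptic_of_mem_bellmanDomain (hQ : 1 ≤ Q) (hV : V ∈ bellmanDomain H Q) (X Y : ℝ) :
    Elliptic (X, Y, V.2.2.1, V.2.2.2, coupling Q V.2.2) := by
  obtain ⟨-, -, hr, hs, -, h2⟩ := hV
  exact ⟨hr, hs, coupling_pos (by linarith) hr hs h2, coupling_sq_lt hQ hr hs h2⟩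

lemma concaveWeight_pos_of_mem (hQ : 1 ≤ Q) (hV : V ∈ bellmanDomain H Q) :
    0 < concaveWeight Q V.2.2 := by
  obtain ⟨-, -, hr, hs, h1, h2⟩ := hV
  exact concaveWeight_pos hQ hr hs h1 h2

lemma concaveWeight_swap_pos_of_mem (hQ : 1 ≤ Q) (hV : V ∈ bellmanDomain H Q) :
    0 < concaveWeight Q V.2.2.swap := by
  obtain ⟨-, -, hr, hs, h1, h2⟩ := hV
  exact concaveWeight_pos (w := V.2.2.swap) hQ hs hr (by rwa [mul_comm] at h1)
    (by rwa [mul_comm] at h2)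

lemma bellman_nonneg (hQ : 1 ≤ Q) (hδ : 0 < δ) (hV : V ∈ bellmanDomain H Q) :
    0 ≤ bellman Q δ V := by
  have h1 := concaveWeight_pos_of_mem hQ hV
  have h2 := concaveWeight_swap_pos_of_mem hQ hV
  have h3 := pairSup_nonneg hδ (elliptic_of_mem_bellmanDomain hQ hV ‖V.1‖ ‖V.2.1‖)
  obtain ⟨-, -, hr, hs, -⟩ := hV
  unfold bellman
  positivity

lemma bellman_le (hQ : 1 ≤ Q) (hδ : 0 < δ) (hV : V ∈ bellmanDomain H Q)
    (h1 : 1 ≤ V.2.2.1 * V.2.2.2) (h2 : V.2.2.1 * V.2.2.2 ≤ Q) :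
    bellman Q δ V ≤ 20000 * (‖V.1‖ ^ 2 / V.2.2.1 + ‖V.2.1‖ ^ 2 / V.2.2.2) := by
  have h3 := pairSup_le hδ (elliptic_of_mem_bellmanDomain hQ hV ‖V.1‖ ‖V.2.1‖)
  obtain ⟨-, -, hr, hs, -⟩ := hV
  have h4 := two_mul_le_concaveWeight hQ hr hs h1 h2
  have h5 := two_mul_le_concaveWeight (w := V.2.2.swap) hQ hs hr (by rwa [mul_comm] at h1)
    (by rwa [mul_comm] at h2)
  have h6 : ‖V.1‖ ^ 2 / concaveWeight Q V.2.2 ≤ ‖V.1‖ ^ 2 / V.2.2.1 := by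
    gcongr; linarith
  have h7 : ‖V.2.1‖ ^ 2 / concaveWeight Q V.2.2.swap ≤ ‖V.2.1‖ ^ 2 / V.2.2.2 := by
    gcongr; simp only [Prod.fst_swap] at h5; linarith
  have h8 : 0 ≤ ‖V.1‖ ^ 2 / V.2.2.1 := by positivity
  have h9 : 0 ≤ ‖V.2.1‖ ^ 2 / V.2.2.2 := by positivity
  dsimp only at h3
  unfold bellman
  linarith

variable [InnerProductSpace ℝ H]

lemma contDiffAt_bellman (hQ : 1 ≤ Q) (hδ : 0 < δ) (hV : V ∈ bellmanDomain H Q) :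
    ContDiffAt ℝ ∞ (bellman Q δ) V := by
  have hw1 := concaveWeight_pos_of_mem hQ hV
  have hw2 := concaveWeight_swap_pos_of_mem hQ hV
  have hell := elliptic_of_mem_bellmanDomain hQ hV ‖V.1‖ ‖V.2.1‖
  obtain ⟨hx, hy, hr, hs, -, -⟩ := hV
  have c1 : ContDiffAt ℝ ∞ (fun V : H × H × ℝ × ℝ => ‖V.1‖) V := contDiffAt_fst.norm ℝ hx
  have c2 : ContDiffAt ℝ ∞ (fun V : H × H × ℝ × ℝ => ‖V.2.1‖) V :=
    ContDiffAt.norm ℝ (by fun_prop) hy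
  have c3 : ContDiffAt ℝ ∞ (fun V : H × H × ℝ × ℝ => concaveWeight Q V.2.2) V :=
    (contDiffAt_concaveWeight hs.ne').comp V (f := fun V : H × H × ℝ × ℝ => V.2.2) (by fun_prop)
  have c4 : ContDiffAt ℝ ∞ (fun V : H × H × ℝ × ℝ => concaveWeight Q V.2.2.swap) V :=
    (contDiffAt_concaveWeight (w := V.2.2.swap) hr.ne').comp V
      (f := fun V : H × H × ℝ × ℝ => (V.2.2.2, V.2.2.1)) (by fun_prop)
  have c5 : ContDiffAt ℝ ∞ (fun V : H × H × ℝ × ℝ => coupling Q V.2.2) V :=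
    (contDiffAt_coupling (by linarith) hr hs).comp V (f := fun V : H × H × ℝ × ℝ => V.2.2)
      (by fun_prop)
  have c6 : ContDiffAt ℝ ∞ (fun V : H × H × ℝ × ℝ =>
      pairSup δ (‖V.1‖, ‖V.2.1‖, V.2.2.1, V.2.2.2, coupling Q V.2.2)) V :=
    (contDiffAt_pairSup hδ hell).comp V
      (f := fun V : H × H × ℝ × ℝ => (‖V.1‖, ‖V.2.1‖, V.2.2.1, V.2.2.2, coupling Q V.2.2))
      (by fun_prop)
  have c7 : ContDiffAt ℝ ∞ (fun V : H × H × ℝ × ℝ => V.2.2.1) V := by fun_prop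
  have c8 : ContDiffAt ℝ ∞ (fun V : H × H × ℝ × ℝ => V.2.2.2) V := by fun_prop
  exact ((contDiffAt_const.mul (((c1.pow 2).div c7 hr.ne').add ((c2.pow 2).div c8 hs.ne'))).add
    (contDiffAt_const.mul (((c1.pow 2).div c3 hw1.ne').add ((c2.pow 2).div c4 hw2.ne')))).add
    (contDiffAt_const.mul c6)

/-- The variational formula for `|x|²/m` with its exact defect. The defect at `m = r` supplies the
squares `a²/r`, `b²/s` of the one-leg estimate. -/
lemma norm_sq_div_eq {m : ℝ} (hm : 0 < m) (c x : H) :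
    ‖x‖ ^ 2 / m = 2 * inner ℝ c x - ‖c‖ ^ 2 * m + ‖x - m • c‖ ^ 2 / m := by
  rw [norm_sub_sq_real, inner_smul_right, norm_smul, Real.norm_of_nonneg hm.le,
    real_inner_comm x c]
  field_simp
  ring

lemma exists_clm_eq (a b : H) (α β : ℝ) : ∃ L : H × H × ℝ × ℝ →L[ℝ] ℝ,
    ∀ V, L V = inner ℝ a V.1 + inner ℝ b V.2.1 + α * V.2.2.1 + β * V.2.2.2 := by
  let p₁ := ContinuousLinearMap.fst ℝ H (H × ℝ × ℝ)
  let p₂ := ContinuousLinearMap.snd ℝ H (H × ℝ × ℝ)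
  let p₃ := ContinuousLinearMap.snd ℝ H (ℝ × ℝ) ∘L p₂
  refine ⟨innerSL ℝ a ∘L p₁ + innerSL ℝ b ∘L ContinuousLinearMap.fst ℝ H (ℝ × ℝ) ∘L p₂
    + α • ContinuousLinearMap.fst ℝ ℝ ℝ ∘L p₃ + β • ContinuousLinearMap.snd ℝ ℝ ℝ ∘L p₃,
    fun V => ?_⟩
  simp [p₁, p₂, p₃]

lemma oneLeg_bellman_weights (Q : ℝ) {w₀ : ℝ × ℝ} (hQ : 0 < Q) (hr : 0 < w₀.1) (hs : 0 < w₀.2)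
    (α β γ : ℝ) :
    DifferentiableAt ℝ (fun w : ℝ × ℝ => -α * concaveWeight Q w + -β * concaveWeight Q w.swap
      + -γ * coupling Q w) w₀ ∧
    ∀ w, oneLeg (fun w : ℝ × ℝ => -α * concaveWeight Q w + -β * concaveWeight Q w.swap
      + -γ * coupling Q w) w₀ w = α * -oneLeg (concaveWeight Q) w₀ w
        + β * -oneLeg (concaveWeight Q) w₀.swap w.swap + γ * -oneLeg (coupling Q) w₀ w := by
  let σ : ℝ × ℝ →L[ℝ] ℝ × ℝ := (ContinuousLinearMap.snd ℝ ℝ ℝ).prod (ContinuousLinearMap.fst ℝ ℝ ℝ)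
  have d1 : DifferentiableAt ℝ (concaveWeight Q) w₀ :=
    (contDiffAt_concaveWeight hs.ne').differentiableAt (by simp)
  have d2' : DifferentiableAt ℝ (concaveWeight Q) (σ w₀) :=
    (contDiffAt_concaveWeight (w := w₀.swap) hr.ne').differentiableAt (by simp)
  have d2 : DifferentiableAt ℝ (fun w : ℝ × ℝ => concaveWeight Q w.swap) w₀ :=
    d2'.comp w₀ σ.differentiableAt
  have d3 : DifferentiableAt ℝ (coupling Q) w₀ :=
    (contDiffAt_coupling hQ hr hs).differentiableAt (by simp)
  have e2 : ∀ w, oneLeg (fun w : ℝ × ℝ => concaveWeight Q w.swap) w₀ w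
      = oneLeg (concaveWeight Q) w₀.swap w.swap := fun w => oneLeg_comp_clm σ d2' w
  have d12 : DifferentiableAt ℝ (fun w : ℝ × ℝ =>
      -α * concaveWeight Q w + -β * concaveWeight Q w.swap) w₀ :=
    (d1.const_mul _).add (d2.const_mul _)
  refine ⟨d12.add (d3.const_mul _), fun w => ?_⟩
  rw [oneLeg_add d12 (d3.const_mul _), oneLeg_add (d1.const_mul _) (d2.const_mul _),
    oneLeg_const_mul _ d1, oneLeg_const_mul _ d2, oneLeg_const_mul _ d3, e2]
  ring

/-- The maximizer defining the coupled part of the Bellman function is nonnegative, and comparable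
to `(|x| / r, |y| / s)` when `|x|` and `|y|` are balanced. -/
lemma exists_maximizer (hδ : 0 < δ) {X Y r s k : ℝ} (hP : Elliptic (X, Y, r, s, k)) (hk : k ≤ 1)
    (hX : 4 * δ ≤ X) (hY : 4 * δ ≤ Y) :
    ∃ c d, 0 ≤ c ∧ 0 ≤ d ∧ pairSup δ (X, Y, r, s, k) = pairFunctional δ (X, Y, r, s, k) (c, d) ∧
      (2 * X ≤ r * Y → 2 * Y ≤ s * X → X / r * (Y / s) / 16 ≤ c * d) := by
  obtain ⟨⟨c, d⟩, hz, hsup⟩ := exists_pairSup_eq hδ hP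
  obtain ⟨hr, hs, hk0, -⟩ := hP
  dsimp only at hr hs hk0
  have hA := softAbs_pos hδ c
  have hB := softAbs_pos hδ d
  have hA' := softAbs_le hδ c
  have hB' := softAbs_le hδ d
  have hz1 : r * c + k * (c / softAbs δ c * softAbs δ d) - X = 0 := congrArg Prod.fst hz
  have hz2 : s * d + k * (d / softAbs δ d * softAbs δ c) - Y = 0 := congrArg Prod.snd hz
  have hc : 0 ≤ c := by
    by_contra h
    have h1 : c * (r + k * (softAbs δ d / softAbs δ c)) = X := by
      have : c / softAbs δ c * softAbs δ d = c * (softAbs δ d / softAbs δ c) := by ring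
      rw [this] at hz1; linarith
    have : c * (r + k * (softAbs δ d / softAbs δ c)) ≤ 0 :=
      mul_nonpos_of_nonpos_of_nonneg (by linarith) (by positivity)
    linarith
  have hd : 0 ≤ d := by
    by_contra h
    have h1 : d * (s + k * (softAbs δ c / softAbs δ d)) = Y := by
      have : d / softAbs δ d * softAbs δ c = d * (softAbs δ c / softAbs δ d) := by ring
      rw [this] at hz2; linarith
    have : d * (s + k * (softAbs δ c / softAbs δ d)) ≤ 0 :=
      mul_nonpos_of_nonpos_of_nonneg (by linarith) (by positivity)
    linarith
  refine ⟨c, d, hc, hd, hsup, fun h1 h2 => ?_⟩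
  rw [abs_of_nonneg hc] at hA'
  rw [abs_of_nonneg hd] at hB'
  have hbound : ∀ t u : ℝ, 0 ≤ t → 0 ≤ u →
      0 ≤ k * (t / softAbs δ t * softAbs δ u) ∧ k * (t / softAbs δ t * softAbs δ u) ≤ u + δ := by
    intro t u ht hu
    have h3 := softAbs_pos hδ t
    have h4 := softAbs_pos hδ u
    have h5 := softAbs_le hδ u
    have h6 := (le_abs_self _).trans (abs_div_softAbs_le hδ t)
    rw [abs_of_nonneg hu] at h5
    refine ⟨by positivity, ?_⟩
    calc k * (t / softAbs δ t * softAbs δ u) ≤ 1 * (1 * softAbs δ u) := by gcongr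
      _ ≤ u + δ := by linarith
  obtain ⟨b1, b2⟩ := hbound c d hc hd
  obtain ⟨b3, b4⟩ := hbound d c hd hc
  have hcX : r * c ≤ X := by linarith
  have hdY : s * d ≤ Y := by linarith
  -- Balance gives `d ≤ Y/s ≤ X/2`. Together with `δ ≤ X/4`, the coupling term, at most `d + δ`,
  -- uses at most `3X/4`, so `r c ≥ X/4`; symmetrically `s d ≥ Y/4`.
  have hd2 : d ≤ X / 2 := by nlinarith
  have hc2 : c ≤ Y / 2 := by nlinarith
  have hc3 : X / r ≤ 4 * c := by rw [div_le_iff₀ hr]; linarith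
  have hd3 : Y / s ≤ 4 * d := by rw [div_le_iff₀ hs]; linarith
  have hYs : 0 ≤ Y / s := div_nonneg (by linarith) hs.le
  nlinarith [mul_le_mul hc3 hd3 hYs (by linarith)]

/-- The Taylor remainder of the Bellman function is bounded below by the remainders of the concave
functions of the weights from which it is built. -/
lemma le_oneLeg_bellman (hQ : 1 ≤ Q) (hδ : 0 < δ) (hV₀ : V₀ ∈ bellmanDomain H Q)
    (h1 : 1 ≤ V₀.2.2.1 * V₀.2.2.2) (h2 : V₀.2.2.1 * V₀.2.2.2 ≤ Q)
    (hx : 4 * δ ≤ ‖V₀.1‖) (hy : 4 * δ ≤ ‖V₀.2.1‖) :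
    ∃ κ, 0 ≤ κ ∧ (2 * ‖V₀.1‖ ≤ V₀.2.2.1 * ‖V₀.2.1‖ → 2 * ‖V₀.2.1‖ ≤ V₀.2.2.2 * ‖V₀.1‖ →
        ‖V₀.1‖ / V₀.2.2.1 * (‖V₀.2.1‖ / V₀.2.2.2) / 16 ≤ κ) ∧
      ∀ V ∈ bellmanDomain H Q,
        100 * (‖V.1 - (V.2.2.1 / V₀.2.2.1) • V₀.1‖ ^ 2 / V.2.2.1
          + ‖V.2.1 - (V.2.2.2 / V₀.2.2.2) • V₀.2.1‖ ^ 2 / V.2.2.2)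
        + 100 * ((‖V₀.1‖ / V₀.2.2.1) ^ 2 * -oneLeg (concaveWeight Q) V₀.2.2 V.2.2
          + (‖V₀.2.1‖ / V₀.2.2.2) ^ 2 * -oneLeg (concaveWeight Q) V₀.2.2.swap V.2.2.swap)
        + 12800 * κ * -oneLeg (coupling Q) V₀.2.2 V.2.2 ≤ oneLeg (bellman Q δ) V₀ V := by
  have hQ0 : 0 < Q := by linarith
  have hdiff : DifferentiableAt ℝ (bellman Q δ) V₀ :=
    (contDiffAt_bellman hQ hδ hV₀).differentiableAt (by simp)
  have hell := elliptic_of_mem_bellmanDomain hQ hV₀ ‖V₀.1‖ ‖V₀.2.1‖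
  have hm := concaveWeight_pos_of_mem hQ hV₀
  have hn := concaveWeight_swap_pos_of_mem hQ hV₀
  obtain ⟨x₀, y₀, r₀, s₀⟩ := V₀
  obtain ⟨hx0, hy0, hr₀, hs₀, -, -⟩ := id hV₀
  dsimp only [Prod.swap_prod_mk] at *
  have hk : coupling Q (r₀, s₀) ≤ 1 :=
    (coupling_lt (w := (r₀, s₀)) hQ0 hr₀ hs₀).le.trans (sqrt_div_le_one (w₀ := (r₀, s₀)) hQ0 h2)
  obtain ⟨c, d, hc, hd, hsup, hcd⟩ := exists_maximizer hδ hell hk hx hy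
  set κ := softAbs δ c * softAbs δ d - δ ^ 2 with hκ
  have hκcd : c * d ≤ κ := by
    have := abs_mul_le_softAbs_mul hδ c d
    have := le_abs_self (c * d)
    linarith
  refine ⟨κ, (mul_nonneg hc hd).trans hκcd, fun h3 h4 => (hcd h3 h4).trans hκcd, ?_⟩
  set m₀ := concaveWeight Q (r₀, s₀) with hm₀
  set n₀ := concaveWeight Q (s₀, r₀) with hn₀
  set p := r₀⁻¹ • x₀ with hp
  set q := s₀⁻¹ • y₀ with hq
  set p' := m₀⁻¹ • x₀ with hp'
  set q' := n₀⁻¹ • y₀ with hq'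
  set u := ‖x₀‖⁻¹ • x₀ with hu
  set v := ‖y₀‖⁻¹ • y₀ with hv
  have hX0 : 0 < ‖x₀‖ := norm_pos_iff.2 hx0
  have hY0 : 0 < ‖y₀‖ := norm_pos_iff.2 hy0
  have hunit : ∀ x : H, inner ℝ u x ≤ ‖x‖ := fun x => by
    refine (real_inner_le_norm u x).trans (le_of_eq ?_)
    rw [hu, norm_smul, norm_inv, norm_norm, inv_mul_cancel₀ hX0.ne', one_mul]
  have hvnit : ∀ y : H, inner ℝ v y ≤ ‖y‖ := fun y => by
    refine (real_inner_le_norm v y).trans (le_of_eq ?_)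
    rw [hv, norm_smul, norm_inv, norm_norm, inv_mul_cancel₀ hY0.ne', one_mul]
  have hux : inner ℝ u x₀ = ‖x₀‖ := by
    rw [hu, inner_smul_left, real_inner_self_eq_norm_sq]; simp; field_simp
  have hvy : inner ℝ v y₀ = ‖y₀‖ := by
    rw [hv, inner_smul_left, real_inner_self_eq_norm_sq]; simp; field_simp
  -- The linear part of the minorant `G`, all parameters being frozen at their optimal values at
  -- `V₀`; the nonlinear weight functions are collected in `g` below.
  obtain ⟨L, hL⟩ := exists_clm_eq ((200 : ℝ) • p + (7200 : ℝ) • p' + (12800 * c) • u)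
    ((200 : ℝ) • q + (7200 : ℝ) • q' + (12800 * d) • v)
    (-100 * ‖p‖ ^ 2 - 6400 * c ^ 2) (-100 * ‖q‖ ^ 2 - 6400 * d ^ 2)
  obtain ⟨hgd, hg⟩ := oneLeg_bellman_weights Q (w₀ := (r₀, s₀)) hQ0 hr₀ hs₀
    (3600 * ‖p'‖ ^ 2) (3600 * ‖q'‖ ^ 2) (12800 * κ)
  set g : ℝ × ℝ → ℝ := fun w => -(3600 * ‖p'‖ ^ 2) * concaveWeight Q w
    + -(3600 * ‖q'‖ ^ 2) * concaveWeight Q w.swap + -(12800 * κ) * coupling Q w with hgdef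
  let π := ContinuousLinearMap.snd ℝ H (ℝ × ℝ) ∘L ContinuousLinearMap.snd ℝ H (H × ℝ × ℝ)
  have hgd' : DifferentiableAt ℝ (fun V : H × H × ℝ × ℝ => g V.2.2) (x₀, y₀, r₀, s₀) :=
    DifferentiableAt.comp (g := g) (f := π) (x₀, y₀, r₀, s₀) hgd π.differentiableAt
  set G : H × H × ℝ × ℝ → ℝ := fun V => L V + g V.2.2 with hG
  have hGexp : ∀ V : H × H × ℝ × ℝ, G V =
      100 * ((2 * inner ℝ p V.1 - ‖p‖ ^ 2 * V.2.2.1) + (2 * inner ℝ q V.2.1 - ‖q‖ ^ 2 * V.2.2.2))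
      + 3600 * ((2 * inner ℝ p' V.1 - ‖p'‖ ^ 2 * concaveWeight Q V.2.2)
        + (2 * inner ℝ q' V.2.1 - ‖q'‖ ^ 2 * concaveWeight Q V.2.2.swap))
      + 6400 * (2 * c * inner ℝ u V.1 + 2 * d * inner ℝ v V.2.1 - c ^ 2 * V.2.2.1
        - d ^ 2 * V.2.2.2 - 2 * coupling Q V.2.2 * κ) := fun V => by
    simp only [hG, hgdef, hL, inner_add_left, inner_smul_left]
    simp
    ring
  have hge : ∀ V ∈ bellmanDomain H Q, G V
      + 100 * (‖V.1 - V.2.2.1 • p‖ ^ 2 / V.2.2.1 + ‖V.2.1 - V.2.2.2 • q‖ ^ 2 / V.2.2.2)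
        ≤ bellman Q δ V := by
    intro V hV
    have hm := concaveWeight_pos_of_mem hQ hV
    have hn := concaveWeight_swap_pos_of_mem hQ hV
    have hs := pairFunctional_le_pairSup hδ (elliptic_of_mem_bellmanDomain hQ hV ‖V.1‖ ‖V.2.1‖)
      (c, d)
    obtain ⟨-, -, hr, hs', -⟩ := hV
    rw [hGexp, bellman, norm_sq_div_eq hr p V.1, norm_sq_div_eq hs' q V.2.1,
      norm_sq_div_eq hm p' V.1, norm_sq_div_eq hn q' V.2.1]
    have e1 : 0 ≤ ‖V.1 - concaveWeight Q V.2.2 • p'‖ ^ 2 / concaveWeight Q V.2.2 := by positivity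
    have e2 : 0 ≤ ‖V.2.1 - concaveWeight Q V.2.2.swap • q'‖ ^ 2 / concaveWeight Q V.2.2.swap := by
      positivity
    have e3 := mul_le_mul_of_nonneg_left (hunit V.1) hc
    have e4 := mul_le_mul_of_nonneg_left (hvnit V.2.1) hd
    simp only [pairFunctional] at hs
    rw [← hκ] at hs
    linarith
  have heq : G (x₀, y₀, r₀, s₀) = bellman Q δ (x₀, y₀, r₀, s₀) := by
    have e : ∀ {m : ℝ} (x : H), 0 < m →
        ‖x‖ ^ 2 / m = 2 * inner ℝ (m⁻¹ • x) x - ‖m⁻¹ • x‖ ^ 2 * m := fun {m} x hm => by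
      rw [norm_sq_div_eq hm (m⁻¹ • x), smul_inv_smul₀ hm.ne']
      simp
    rw [hGexp, bellman]
    dsimp only [Prod.swap_prod_mk]
    rw [hsup, e x₀ hr₀, e y₀ hs₀, ← hm₀, ← hn₀, e x₀ hm, e y₀ hn, hux, hvy]
    simp only [pairFunctional]
    rw [← hκ]
  have hGd : DifferentiableAt ℝ G (x₀, y₀, r₀, s₀) := L.differentiableAt.add hgd'
  have hleg := oneLeg_eq_add_sub_of_le hdiff hGd (by
    filter_upwards [isOpen_bellmanDomain.mem_nhds hV₀] with V hV
    refine le_trans ?_ (hge V hV)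
    obtain ⟨-, -, hr, hs, -⟩ := hV
    have : 0 ≤ 100 * (‖V.1 - V.2.2.1 • p‖ ^ 2 / V.2.2.1
      + ‖V.2.1 - V.2.2.2 • q‖ ^ 2 / V.2.2.2) := by positivity
    linarith) heq
  intro V hV
  have hGleg : oneLeg G (x₀, y₀, r₀, s₀) V = oneLeg g (r₀, s₀) V.2.2 := by
    rw [hG, oneLeg_clm_add L hgd']
    exact oneLeg_comp_clm π (f := g) (W₀ := (x₀, y₀, r₀, s₀)) hgd V
  rw [hleg, hGleg, hg]
  have hfin := hge V hV
  obtain ⟨-, -, hr, hs, -⟩ := hV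
  -- Since `m ≤ 6r`, the coefficient `3600|x₀|²/m²` is at least `100|x₀|²/r²`; this is the origin of
  -- `3600 = 36 · 100`.
  have hpn : ∀ {m r : ℝ} (x : H), 0 < r → 0 < m → m ≤ 6 * r →
      (‖x‖ / r) ^ 2 ≤ 36 * ‖m⁻¹ • x‖ ^ 2 := fun {m r} x hr hm hmr => by
    rw [norm_smul, norm_inv, Real.norm_of_nonneg hm.le, show (36 : ℝ) = 6 ^ 2 by norm_num,
      ← mul_pow]
    have : ‖x‖ / r ≤ 6 * (m⁻¹ * ‖x‖) := by
      rw [div_le_iff₀ hr, ← div_eq_inv_mul, mul_div_assoc', div_mul_eq_mul_div, le_div_iff₀ hm]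
      nlinarith [norm_nonneg x]
    gcongr
  have f1 := hpn x₀ hr₀ hm (concaveWeight_le (w := (r₀, s₀)) hr₀ hs₀)
  have f2 := hpn y₀ hs₀ hn (concaveWeight_le (w := (s₀, r₀)) hs₀ hr₀)
  have g1 : 0 ≤ -oneLeg (concaveWeight Q) (r₀, s₀) V.2.2 :=
    le_trans (by positivity) (le_neg_oneLeg_concaveWeight (w := V.2.2) (w₀ := (r₀, s₀)) hQ0 hr₀ hs₀
      h2 hs)
  have g2 : 0 ≤ -oneLeg (concaveWeight Q) (s₀, r₀) V.2.2.swap :=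
    le_trans (by have : 0 < V.2.2.swap.2 := hr
                 positivity) (le_neg_oneLeg_concaveWeight (w := V.2.2.swap) (w₀ := (s₀, r₀)) hQ0
      hs₀ hr₀ (by rwa [mul_comm] at h2) hr)
  have k1 := mul_le_mul_of_nonneg_right f1 g1
  have k2 := mul_le_mul_of_nonneg_right f2 g2
  rw [← hp'] at k1
  rw [← hq'] at k2
  rw [hp, hq, smul_smul, smul_smul, ← div_eq_mul_inv, ← div_eq_mul_inv] at hfin
  dsimp only [Prod.swap_prod_mk] at *
  linarith

end Bellman

/-! ### Convexity of the Bellman function -/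

lemma mul_mul_le_of_sq_le {t α β : ℝ} (hα : 0 ≤ α) (hβ : 0 ≤ β) (h : t ^ 2 ≤ 4 * (α * β))
    (u v : ℝ) : t * (u * v) ≤ α * u ^ 2 + β * v ^ 2 := by
  refine (abs_le_of_sq_le_sq' ?_ (by positivity)).2
  calc (t * (u * v)) ^ 2 = t ^ 2 * (u * v) ^ 2 := by ring
    _ ≤ 4 * (α * β) * (u * v) ^ 2 := by gcongr
    _ ≤ (α * u ^ 2 + β * v ^ 2) ^ 2 := by nlinarith [sq_nonneg (α * u ^ 2 - β * v ^ 2)]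

/-! ### Scalar inequalities for one-leg convexity and for the ellipse. -/

section Reals

variable {Q : ℝ}

/-- The product of the weight increments is controlled when `p r₀ ≤ 2 q`. -/
lemma mul_mul_le_of_unbalanced {p q r r₀ ρ σ : ℝ} (hQ : 0 < Q) (hq : 0 ≤ q)
    (hr : 0 < r) (hr₀ : 0 < r₀) (hρ : 0 ≤ ρ) (hσ : 0 ≤ σ) (h : p * r₀ ≤ 2 * q) :
    1 / Q * ((p * ρ) * (q * σ)) ≤
      2 * (q ^ 2 * (r * σ ^ 2 / (2 * Q ^ 2) + ρ ^ 2 / (r * r₀ ^ 2))) := by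
  have h1 : 1 / (Q * r₀) * (σ * ρ) ≤ r / (2 * Q ^ 2) * σ ^ 2 + 1 / (r * r₀ ^ 2) * ρ ^ 2 := by
    refine mul_mul_le_of_sq_le (by positivity) (by positivity) ?_ σ ρ
    have : 4 * (r / (2 * Q ^ 2) * (1 / (r * r₀ ^ 2))) = 2 * (1 / (Q * r₀)) ^ 2 := by
      field_simp; norm_num
    rw [this]
    nlinarith [sq_nonneg (1 / (Q * r₀))]
  calc 1 / Q * ((p * ρ) * (q * σ)) = p * r₀ * (q * (1 / (Q * r₀) * (σ * ρ))) := by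
        field_simp
    _ ≤ 2 * q * (q * (r / (2 * Q ^ 2) * σ ^ 2 + 1 / (r * r₀ ^ 2) * ρ ^ 2)) := by gcongr
    _ = _ := by ring

/-- The pointwise inequality behind discrete one-leg convexity. -/
lemma mul_add_mul_add_le {p q r s r₀ s₀ ρ σ a b κ δm δn δk : ℝ} (hQ1 : 1 ≤ Q) (hp : 0 ≤ p)
    (hq : 0 ≤ q) (hr : 0 < r) (hs : 0 < s) (hr₀ : 0 < r₀) (hs₀ : 0 < s₀) (hρ : 0 ≤ ρ) (hσ : 0 ≤ σ)
    (hκ : 0 ≤ κ) (hVQ : r * s ≤ Q)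
    (hκR : 2 * p ≤ q * s₀ → 2 * q ≤ p * r₀ → p * q / 16 ≤ κ)
    (hm : s * ρ ^ 2 / (2 * Q ^ 2) + σ ^ 2 / (s * s₀ ^ 2) ≤ δm)
    (hn : r * σ ^ 2 / (2 * Q ^ 2) + ρ ^ 2 / (r * r₀ ^ 2) ≤ δn)
    (hk : ρ * σ / (8 * Q) ≤ δk) :
    1 / Q * ((a + p * ρ) * (b + q * σ)) ≤ 100 * (a ^ 2 / r + b ^ 2 / s)
      + 100 * (p ^ 2 * δm + q ^ 2 * δn) + 12800 * κ * δk := by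
  have hQ : 0 < Q := by linarith
  have hδm : 0 ≤ δm := le_trans (by positivity) hm
  have hδn : 0 ≤ δn := le_trans (by positivity) hn
  have hδk : 0 ≤ δk := le_trans (by positivity) hk
  have hm' := mul_le_mul_of_nonneg_left hm (sq_nonneg p)
  have hn' := mul_le_mul_of_nonneg_left hn (sq_nonneg q)
  have t1 : 1 / Q * (a * b) ≤ 1 / r * a ^ 2 + 1 / s * b ^ 2 := by
    refine mul_mul_le_of_sq_le (by positivity) (by positivity) ?_ a b
    have e1 : (1 / Q) ^ 2 ≤ 1 / Q := by
      rw [div_pow, one_pow]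
      exact one_div_le_one_div_of_le hQ (by nlinarith)
    have e2 : 1 / Q ≤ 1 / (r * s) := one_div_le_one_div_of_le (by positivity) hVQ
    have e3 : 1 / r * (1 / s) = 1 / (r * s) := by field_simp
    have e4 : 0 < 1 / (r * s) := by positivity
    rw [e3]; linarith
  have t2 : 1 / Q * ((p * ρ) * b) ≤ s / (2 * Q ^ 2) * (p * ρ) ^ 2 + 1 / s * b ^ 2 := by
    refine mul_mul_le_of_sq_le (by positivity) (by positivity) ?_ (p * ρ) b
    have : 4 * (s / (2 * Q ^ 2) * (1 / s)) = 2 * (1 / Q) ^ 2 := by field_simp; norm_num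
    rw [this]; nlinarith [sq_nonneg (1 / Q)]
  have t3 : 1 / Q * ((q * σ) * a) ≤ r / (2 * Q ^ 2) * (q * σ) ^ 2 + 1 / r * a ^ 2 := by
    refine mul_mul_le_of_sq_le (by positivity) (by positivity) ?_ (q * σ) a
    have : 4 * (r / (2 * Q ^ 2) * (1 / r)) = 2 * (1 / Q) ^ 2 := by field_simp; norm_num
    rw [this]; nlinarith [sq_nonneg (1 / Q)]
  have t4 : 1 / Q * ((p * ρ) * (q * σ)) ≤ 2 * (p ^ 2 * δm) + 2 * (q ^ 2 * δn)
      + 12800 * κ * δk := by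
    have n1 : 0 ≤ p ^ 2 * δm := by positivity
    have n2 : 0 ≤ q ^ 2 * δn := by positivity
    have n3 : 0 ≤ 12800 * κ * δk := by positivity
    -- In the balanced case `κ ≥ pq/16` and the coupling pays, with constant `12800/(16 · 8) = 100`.
    -- Otherwise one of `p`, `q` dominates, and its own concave weight controls both increments.
    by_cases hR1 : 2 * p ≤ q * s₀
    · by_cases hR2 : 2 * q ≤ p * r₀
      · have := hκR hR1 hR2
        have e : 12800 * (p * q / 16) * (ρ * σ / (8 * Q)) ≤ 12800 * κ * δk := by gcongr
        have e' : 12800 * (p * q / 16) * (ρ * σ / (8 * Q)) =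
            100 * (1 / Q * ((p * ρ) * (q * σ))) := by
          field_simp; ring
        have e'' : 0 ≤ 1 / Q * ((p * ρ) * (q * σ)) := by positivity
        linarith
      · have := mul_mul_le_of_unbalanced hQ hq hr hr₀ hρ hσ (not_le.1 hR2).le
        linarith
    · have := mul_mul_le_of_unbalanced hQ hp hs hs₀ hσ hρ (not_le.1 hR1).le
      rw [mul_comm (q * σ)] at this
      linarith
  have m1 : s / (2 * Q ^ 2) * (p * ρ) ^ 2 ≤ p ^ 2 * δm := by
    have : 0 ≤ p ^ 2 * (σ ^ 2 / (s * s₀ ^ 2)) := by positivity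
    have e : s / (2 * Q ^ 2) * (p * ρ) ^ 2 = p ^ 2 * (s * ρ ^ 2 / (2 * Q ^ 2)) := by ring
    rw [e]; linarith
  have m2 : r / (2 * Q ^ 2) * (q * σ) ^ 2 ≤ q ^ 2 * δn := by
    have : 0 ≤ q ^ 2 * (ρ ^ 2 / (r * r₀ ^ 2)) := by positivity
    have e : r / (2 * Q ^ 2) * (q * σ) ^ 2 = q ^ 2 * (r * σ ^ 2 / (2 * Q ^ 2)) := by ring
    rw [e]; linarith
  have e1 : 1 / r * a ^ 2 = a ^ 2 / r := by ring
  have e2 : 1 / s * b ^ 2 = b ^ 2 / s := by ring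
  have e3 : 1 / Q * ((a + p * ρ) * (b + q * σ)) = 1 / Q * (a * b) + 1 / Q * ((p * ρ) * b)
      + 1 / Q * ((q * σ) * a) + 1 / Q * ((p * ρ) * (q * σ)) := by ring
  have z1 : 0 ≤ a ^ 2 / r := by positivity
  have z2 : 0 ≤ b ^ 2 / s := by positivity
  have z3 : 0 ≤ p ^ 2 * δm := by positivity
  have z4 : 0 ≤ q ^ 2 * δn := by positivity
  rw [e1, e2] at t1
  rw [e2] at t2
  rw [e1] at t3
  linarith

/-- The ellipse bound, in terms of `t = |y| / |x|`. -/
lemma eccentricity_bounds (hQ : 1 ≤ Q) {r s t : ℝ} (hr : 0 < r) (hs : 0 < s) (ht : 0 < t)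
    (h2 : r * s ≤ Q) {χ τ : ℝ} (hχ : 0 ≤ χ) (hχ1 : 2 ≤ r * t → 2 * t ≤ s → χ = 1)
    (hτ : τ = min (Q / r) (s / Q + Q * t ^ 2 / (r * s ^ 2) + max 0 (t - 2 / r))) :
    τ ≤ 25 * (s / Q + Q * t ^ 2 / (r * s ^ 2) + χ * t) ∧
      1 / τ ≤ 25 * (r / Q + Q / (t ^ 2 * r ^ 2 * s) + χ / t) := by
  have hQ0 : 0 < Q := by linarith
  have n1 : 0 < s / Q := by positivity
  have n2 : 0 < Q * t ^ 2 / (r * s ^ 2) := by positivity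
  have n3 : 0 ≤ χ * t := by positivity
  have n4 : 0 < r / Q := by positivity
  have n5 : 0 < Q / (t ^ 2 * r ^ 2 * s) := by positivity
  have n6 : 0 ≤ χ / t := by positivity
  have n7 : 0 < Q / r := by positivity
  have hm0 := le_max_left 0 (t - 2 / r)
  have hm1 := le_max_right 0 (t - 2 / r)
  have hτ1 : τ ≤ Q / r := hτ ▸ min_le_left _ _
  have hτ2 : τ ≤ s / Q + Q * t ^ 2 / (r * s ^ 2) + max 0 (t - 2 / r) := hτ ▸ min_le_right _ _
  have hτs : s / Q ≤ τ := by
    rw [hτ]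
    refine le_min ?_ (by linarith)
    rw [div_le_div_iff₀ hQ0 hr]
    nlinarith
  have hτ0 : 0 < τ := n1.trans_le hτs
  have hinv : 1 / τ ≤ Q / s := by
    rw [div_le_div_iff₀ hτ0 hs]
    rw [div_le_iff₀ hQ0] at hτs
    linarith
  have hsmall : r * t ≤ 4 → 1 / τ ≤ 16 * (Q / (t ^ 2 * r ^ 2 * s)) := fun h => by
    refine hinv.trans ?_
    rw [mul_div_assoc', div_le_div_iff₀ hs (by positivity)]
    have : t ^ 2 * r ^ 2 ≤ 16 := by
      have : 0 < r * t := by positivity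
      nlinarith
    nlinarith [mul_le_mul_of_nonneg_left this (mul_pos hQ0 hs).le]
  have hdiv : ∀ {M : ℝ}, 0 < M → M ≤ τ → 1 / τ ≤ 1 / M := fun hM h =>
    one_div_le_one_div_of_le hM h
  -- If `rt < 2`, the positive part vanishes and `1/τ ≤ Q/s` suffices. If `s < 2t`, the term
  -- `Qt²/(rs²)` is at least `Q/(4r)`, so `τ` is comparable to `Q/r`. Otherwise `χ = 1`.
  by_cases c1 : r * t < 2
  · have hmax : max 0 (t - 2 / r) = 0 := by
      refine max_eq_left ?_
      rw [sub_nonpos, le_div_iff₀ hr]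
      linarith
    have := hsmall (by linarith)
    constructor <;> linarith
  · by_cases c2 : s < 2 * t
    · have hbig : Q / (4 * r) ≤ Q * t ^ 2 / (r * s ^ 2) := by
        rw [div_le_div_iff₀ (by positivity) (by positivity)]
        have : s ^ 2 ≤ 4 * t ^ 2 := by nlinarith
        nlinarith [mul_le_mul_of_nonneg_left this (mul_pos hQ0 hr).le]
      have e : Q / (4 * r) = Q / r / 4 := by field_simp
      have hlow : Q / (4 * r) ≤ τ := by
        rw [hτ]
        refine le_min ?_ ?_ <;> linarith
      have hlow' := hdiv (by positivity) hlow
      have e' : 1 / (Q / (4 * r)) = 4 * (r / Q) := by field_simp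
      constructor <;> linarith
    · have hχ1 := hχ1 (by linarith) (by linarith)
      subst hχ1
      have hr2 : 0 < 2 / r := by positivity
      have hmax : max 0 (t - 2 / r) ≤ t := max_le ht.le (by linarith)
      refine ⟨by linarith, ?_⟩
      by_cases c3 : r * t ≤ 4
      · have := hsmall c3
        linarith
      · have h3 : t / 2 ≤ t - 2 / r := by
          have : 2 / r ≤ t / 2 := by
            rw [div_le_div_iff₀ hr (by norm_num)]
            linarith
          linarith
        rcases min_choice (Q / r) (s / Q + Q * t ^ 2 / (r * s ^ 2) + max 0 (t - 2 / r)) with h | h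
        · rw [h] at hτ
          have : 1 / τ = r / Q := by rw [hτ]; field_simp
          linarith
        · rw [h] at hτ
          have hlow' := hdiv (by positivity) (show t / 2 ≤ τ by linarith)
          have e : 1 / (t / 2) = 2 * (1 / t) := by field_simp
          have : 0 < 1 / t := by positivity
          linarith

end Reals

/-! ### The continuous eccentricity function. -/

section Eccentricity

variable {H : Type*} [NormedAddCommGroup H] {Q : ℝ} {V : H × H × ℝ × ℝ}

/-- The eccentricity of the ellipse. -/
noncomputable def eccentricity (Q : ℝ) (V : H × H × ℝ × ℝ) : ℝ :=
  min (Q / V.2.2.1) (V.2.2.2 / Q + Q * (‖V.2.1‖ / ‖V.1‖) ^ 2 / (V.2.2.1 * V.2.2.2 ^ 2)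
    + max 0 (‖V.2.1‖ / ‖V.1‖ - 2 / V.2.2.1))

/-- The indicator of the balanced case is discontinuous; `max 0 (t - 2/r)`, with `t = |y|/|x|`, is
its continuous stand-in for `χ t`. It vanishes for `rt ≤ 2` and is at least `t/2` for `rt ≥ 4`. -/
lemma continuousOn_eccentricity (Q : ℝ) (hQ : 0 < Q) :
    ContinuousOn (eccentricity Q) (bellmanDomain H Q) := by
  intro V hV
  obtain ⟨hx, -, hr, hs, -⟩ := hV
  have hx' : ‖V.1‖ ≠ 0 := norm_ne_zero_iff.2 hx
  have hrs : V.2.2.1 * V.2.2.2 ^ 2 ≠ 0 := by positivity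
  have hr' := hr.ne'
  refine ContinuousAt.continuousWithinAt ?_
  unfold eccentricity
  fun_prop (disch := first | assumption | exact hQ.ne')

lemma le_eccentricity (hQ : 1 ≤ Q) (hV : V ∈ bellmanDomain H Q) (h2 : V.2.2.1 * V.2.2.2 ≤ Q) :
    V.2.2.2 / Q ≤ eccentricity Q V := by
  obtain ⟨-, -, hr, hs, -⟩ := hV
  have hQ0 : 0 < Q := by linarith
  refine le_min ?_ ?_
  · rw [div_le_div_iff₀ hQ0 hr]
    nlinarith
  · have h1 : 0 ≤ Q * (‖V.2.1‖ / ‖V.1‖) ^ 2 / (V.2.2.1 * V.2.2.2 ^ 2) := by positivity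
    have h3 := le_max_left 0 (‖V.2.1‖ / ‖V.1‖ - 2 / V.2.2.1)
    linarith

end Eccentricity

/-! ### Discrete one-leg convexity, and the lower bound for the Hessian. -/

section Bellman

variable {H : Type*} [NormedAddCommGroup H] [InnerProductSpace ℝ H] {Q δ : ℝ}
  {V V₀ : H × H × ℝ × ℝ}

lemma norm_sub_le_add (x x₀ : H) {r r₀ : ℝ} (hr₀ : 0 < r₀) :
    ‖x - x₀‖ ≤ ‖x - (r / r₀) • x₀‖ + ‖x₀‖ / r₀ * |r - r₀| := by
  have : x - x₀ = (x - (r / r₀) • x₀) + ((r - r₀) / r₀) • x₀ := by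
    rw [sub_div, sub_smul, div_self hr₀.ne', one_smul]; abel
  calc ‖x - x₀‖ ≤ ‖x - (r / r₀) • x₀‖ + ‖((r - r₀) / r₀) • x₀‖ := by
        rw [this]; exact norm_add_le _ _
    _ = _ := by
      rw [norm_smul, Real.norm_eq_abs, abs_div, abs_of_pos hr₀]; ring

/-- Discrete one-leg convexity. -/
lemma mul_norm_sub_le_oneLeg_bellman (hQ : 1 ≤ Q) (hδ : 0 < δ) (hV₀ : V₀ ∈ bellmanDomain H Q)
    (h1 : 1 ≤ V₀.2.2.1 * V₀.2.2.2) (h2 : V₀.2.2.1 * V₀.2.2.2 ≤ Q)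
    (hx : 4 * δ ≤ ‖V₀.1‖) (hy : 4 * δ ≤ ‖V₀.2.1‖) (hV : V ∈ bellmanDomain H Q)
    (hVQ : V.2.2.1 * V.2.2.2 ≤ Q) :
    1 / Q * (‖V.1 - V₀.1‖ * ‖V.2.1 - V₀.2.1‖) ≤ oneLeg (bellman Q δ) V₀ V := by
  have hQ0 : 0 < Q := by linarith
  obtain ⟨κ, hκ, hκR, hle⟩ := le_oneLeg_bellman hQ hδ hV₀ h1 h2 hx hy
  refine le_trans ?_ (hle V hV)
  obtain ⟨x₀, y₀, r₀, s₀⟩ := V₀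
  obtain ⟨x, y, r, s⟩ := V
  obtain ⟨-, -, hr₀, hs₀, -, -⟩ := hV₀
  obtain ⟨-, -, hr, hs, -, -⟩ := hV
  dsimp only [Prod.swap_prod_mk] at *
  clear hle
  have hm := le_neg_oneLeg_concaveWeight (w₀ := (r₀, s₀)) (w := (r, s)) hQ0 hr₀ hs₀ h2 hs
  have hn := le_neg_oneLeg_concaveWeight (w₀ := (s₀, r₀)) (w := (s, r)) hQ0 hs₀ hr₀
    (by rwa [mul_comm] at h2) hr
  have hk := le_neg_oneLeg_coupling (w₀ := (r₀, s₀)) (w := (r, s)) hQ0 hr₀ hs₀ h2 hr hs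
  dsimp only at hm hn hk
  generalize -oneLeg (concaveWeight Q) (r₀, s₀) (r, s) = δm at *
  generalize -oneLeg (concaveWeight Q) (s₀, r₀) (s, r) = δn at *
  generalize -oneLeg (coupling Q) (r₀, s₀) (r, s) = δk at *
  have hX := norm_sub_le_add x x₀ (r := r) hr₀
  have hY := norm_sub_le_add y y₀ (r := s) hs₀
  have hp0 : 0 ≤ ‖x₀‖ / r₀ := by positivity
  have hq0 : 0 ≤ ‖y₀‖ / s₀ := by positivity
  have hpx : ‖x₀‖ = ‖x₀‖ / r₀ * r₀ := by field_simp
  have hqy : ‖y₀‖ = ‖y₀‖ / s₀ * s₀ := by field_simp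
  set p := ‖x₀‖ / r₀
  set q := ‖y₀‖ / s₀
  set a := ‖x - (r / r₀) • x₀‖
  set b := ‖y - (s / s₀) • y₀‖
  have ha : 0 ≤ a := norm_nonneg _
  have hb : 0 ≤ b := norm_nonneg _
  rw [← sq_abs (r - r₀), ← sq_abs (s - s₀)] at hm hn
  set ρ := |r - r₀|
  set σ := |s - s₀|
  have hρ : 0 ≤ ρ := abs_nonneg _
  have hσ : 0 ≤ σ := abs_nonneg _
  have hprod : 1 / Q * (‖x - x₀‖ * ‖y - y₀‖) ≤ 1 / Q * ((a + p * ρ) * (b + q * σ)) := by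
    gcongr
  refine hprod.trans (mul_add_mul_add_le hQ hp0 hq0 hr hs hr₀ hs₀ hρ hσ hκ hVQ
    (fun c1 c2 => hκR ?_ ?_) hm hn hk)
  · rw [hpx, hqy]
    linarith [mul_le_mul_of_nonneg_right c1 hr₀.le]
  · rw [hpx, hqy]
    linarith [mul_le_mul_of_nonneg_right c2 hs₀.le]

open Classical in
/-- A quadratic form bounding the Hessian of the Bellman function at `V₀` from below. -/
noncomputable def ellipseForm (Q : ℝ) (V₀ dV : H × H × ℝ × ℝ) : ℝ :=
  ‖dV.1 - (dV.2.2.1 / V₀.2.2.1) • V₀.1‖ ^ 2 / V₀.2.2.1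
  + ‖dV.2.1 - (dV.2.2.2 / V₀.2.2.2) • V₀.2.1‖ ^ 2 / V₀.2.2.2
  + (‖V₀.1‖ / V₀.2.2.1) ^ 2 * (V₀.2.2.2 * dV.2.2.1 ^ 2 / Q ^ 2 + dV.2.2.2 ^ 2 / V₀.2.2.2 ^ 3)
  + (‖V₀.2.1‖ / V₀.2.2.2) ^ 2 * (V₀.2.2.1 * dV.2.2.2 ^ 2 / Q ^ 2 + dV.2.2.1 ^ 2 / V₀.2.2.1 ^ 3)
  + (if 2 * ‖V₀.1‖ ≤ V₀.2.2.1 * ‖V₀.2.1‖ ∧ 2 * ‖V₀.2.1‖ ≤ V₀.2.2.2 * ‖V₀.1‖ then 1 else 0) *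
    (‖V₀.1‖ / V₀.2.2.1 * (‖V₀.2.1‖ / V₀.2.2.2) *
      ((V₀.2.2.2 / V₀.2.2.1 * dV.2.2.1 ^ 2 + V₀.2.2.1 / V₀.2.2.2 * dV.2.2.2 ^ 2) / Q))

lemma ellipseForm_smul (t : ℝ) (dV : H × H × ℝ × ℝ) :
    ellipseForm Q V₀ (t • dV) = t ^ 2 * ellipseForm Q V₀ dV := by
  have h : ∀ (x x₀ : H) (r r₀ : ℝ), ‖t • x - (t * r / r₀) • x₀‖ ^ 2
      = t ^ 2 * ‖x - (r / r₀) • x₀‖ ^ 2 := fun x x₀ r r₀ => by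
    rw [mul_div_assoc, ← smul_smul, ← smul_sub, norm_smul, mul_pow, Real.norm_eq_abs, sq_abs]
  simp only [ellipseForm, Prod.smul_fst, Prod.smul_snd, smul_eq_mul, h]
  ring

/-- Near `V₀` the weights stay within a factor two of `r₀`, `s₀`, so the remainder bound can be
frozen at `V₀` and becomes a form homogeneous of degree two in `V - V₀`. -/
lemma ellipseForm_le_hessianForm_bellman (hQ : 1 ≤ Q) (hδ : 0 < δ)
    (hV₀ : V₀ ∈ bellmanDomain H Q)
    (h1 : 1 ≤ V₀.2.2.1 * V₀.2.2.2) (h2 : V₀.2.2.1 * V₀.2.2.2 ≤ Q)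
    (hx : 4 * δ ≤ ‖V₀.1‖) (hy : 4 * δ ≤ ‖V₀.2.1‖) (dV : H × H × ℝ × ℝ) :
    50 * ellipseForm Q V₀ dV ≤ hessianForm (bellman Q δ) V₀ dV := by
  have hQ0 : 0 < Q := by linarith
  have h50 : 50 * ellipseForm Q V₀ dV = 2 * (25 * ellipseForm Q V₀ dV) := by ring
  rw [h50]
  refine le_hessianForm_of_le_oneLeg (contDiffAt_bellman hQ hδ hV₀)
    (fun dV => 25 * ellipseForm Q V₀ dV)
    (fun t v => by simp only [ellipseForm_smul]; ring) ?_ dV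
  obtain ⟨κ, hκ, hκR, hle⟩ := le_oneLeg_bellman hQ hδ hV₀ h1 h2 hx hy
  obtain ⟨-, -, hr₀, hs₀, -, -⟩ := id hV₀
  have hcr : Continuous (fun V : H × H × ℝ × ℝ => V.2.2.1) := by fun_prop
  have hcs : Continuous (fun V : H × H × ℝ × ℝ => V.2.2.2) := by fun_prop
  filter_upwards [isOpen_bellmanDomain.mem_nhds hV₀,
    hcr.continuousAt.eventually_lt continuousAt_const (show V₀.2.2.1 < 2 * V₀.2.2.1 by linarith),
    hcs.continuousAt.eventually_lt continuousAt_const (show V₀.2.2.2 < 2 * V₀.2.2.2 by linarith),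
    continuousAt_const.eventually_lt hcr.continuousAt (show V₀.2.2.1 / 2 < V₀.2.2.1 by linarith),
    continuousAt_const.eventually_lt hcs.continuousAt (show V₀.2.2.2 / 2 < V₀.2.2.2 by linarith)]
    with V hV hr2 hs2 hr3 hs3
  refine le_trans ?_ (hle V hV)
  clear hle hcr hcs
  obtain ⟨x₀, y₀, r₀, s₀⟩ := V₀
  obtain ⟨x, y, r, s⟩ := V
  obtain ⟨-, -, hr, hs, -, -⟩ := hV
  dsimp only [Prod.swap_prod_mk] at *
  have hm := le_neg_oneLeg_concaveWeight (w₀ := (r₀, s₀)) (w := (r, s)) hQ0 hr₀ hs₀ h2 hs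
  have hn := le_neg_oneLeg_concaveWeight (w₀ := (s₀, r₀)) (w := (s, r)) hQ0 hs₀ hr₀
    (by rwa [mul_comm] at h2) hr
  have hk := le_neg_oneLeg_coupling_of_le (w₀ := (r₀, s₀)) (w := (r, s)) hQ0 hr₀ hs₀ h2 hr hs
    hr2.le hs2.le
  dsimp only at hm hn hk
  generalize -oneLeg (concaveWeight Q) (r₀, s₀) (r, s) = δm at *
  generalize -oneLeg (concaveWeight Q) (s₀, r₀) (s, r) = δn at *
  generalize -oneLeg (coupling Q) (r₀, s₀) (r, s) = δk at *
  have hshift : ∀ (x x₀ : H) {r r₀ : ℝ}, 0 < r₀ →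
      x - x₀ - ((r - r₀) / r₀) • x₀ = x - (r / r₀) • x₀ := fun x x₀ r r₀ h => by
    rw [sub_div, sub_smul, div_self h.ne', one_smul]; abel
  simp only [ellipseForm, Prod.mk_sub_mk, hshift x x₀ hr₀, hshift y y₀ hs₀]
  have hp0 : 0 ≤ ‖x₀‖ / r₀ := by positivity
  have hq0 : 0 ≤ ‖y₀‖ / s₀ := by positivity
  set p := ‖x₀‖ / r₀
  set q := ‖y₀‖ / s₀
  set a := ‖x - (r / r₀) • x₀‖
  set b := ‖y - (s / s₀) • y₀‖
  set ρ := r - r₀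
  set σ := s - s₀
  have k1 : 25 * (a ^ 2 / r₀) ≤ 100 * (a ^ 2 / r) := by
    have : a ^ 2 / (2 * r₀) ≤ a ^ 2 / r := by gcongr
    have e : a ^ 2 / (2 * r₀) = a ^ 2 / r₀ / 2 := by field_simp
    have : 0 ≤ a ^ 2 / r₀ := by positivity
    linarith
  have k2 : 25 * (b ^ 2 / s₀) ≤ 100 * (b ^ 2 / s) := by
    have : b ^ 2 / (2 * s₀) ≤ b ^ 2 / s := by gcongr
    have e : b ^ 2 / (2 * s₀) = b ^ 2 / s₀ / 2 := by field_simp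
    have : 0 ≤ b ^ 2 / s₀ := by positivity
    linarith
  have k : ∀ {s s₀ ρ σ D : ℝ}, 0 < s → 0 < s₀ → s < 2 * s₀ → s₀ / 2 < s →
      s * ρ ^ 2 / (2 * Q ^ 2) + σ ^ 2 / (s * s₀ ^ 2) ≤ D →
      25 * (s₀ * ρ ^ 2 / Q ^ 2 + σ ^ 2 / s₀ ^ 3) ≤ 100 * D := by
    intro s s₀ ρ σ D hs hs₀ hlt hgt hD
    have e1 : s₀ / 2 * ρ ^ 2 / (2 * Q ^ 2) ≤ s * ρ ^ 2 / (2 * Q ^ 2) := by gcongr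
    have e2 : σ ^ 2 / (2 * s₀ * s₀ ^ 2) ≤ σ ^ 2 / (s * s₀ ^ 2) := by gcongr
    have e3 : s₀ / 2 * ρ ^ 2 / (2 * Q ^ 2) = s₀ * ρ ^ 2 / Q ^ 2 / 4 := by field_simp; ring
    have e4 : σ ^ 2 / (2 * s₀ * s₀ ^ 2) = σ ^ 2 / s₀ ^ 3 / 2 := by field_simp
    have e5 : 0 ≤ σ ^ 2 / s₀ ^ 3 := by positivity
    linarith
  have k3 := mul_le_mul_of_nonneg_left (k hs hs₀ hs2 hs3 hm) (sq_nonneg p)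
  have k4 := mul_le_mul_of_nonneg_left (k hr hr₀ hr2 hr3 hn) (sq_nonneg q)
  have hW : 0 ≤ s₀ / r₀ * ρ ^ 2 + r₀ / s₀ * σ ^ 2 := by positivity
  set W := s₀ / r₀ * ρ ^ 2 + r₀ / s₀ * σ ^ 2
  have hδk : 0 ≤ δk := le_trans (by positivity) hk
  have k5 : 25 * ((if 2 * ‖x₀‖ ≤ r₀ * ‖y₀‖ ∧ 2 * ‖y₀‖ ≤ s₀ * ‖x₀‖ then 1 else 0) *
      (p * q * (W / Q))) ≤ 12800 * κ * δk := by
    split_ifs with hR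
    · have e : 12800 * (p * q / 16) * (W / (24 * Q)) ≤ 12800 * κ * δk := by
        have := hκR hR.1 hR.2
        gcongr
      have e' : 12800 * (p * q / 16) * (W / (24 * Q)) = 100 / 3 * (p * q * (W / Q)) := by
        field_simp; ring
      have e'' : 0 ≤ p * q * (W / Q) := by positivity
      linarith
    · simp only [zero_mul, mul_zero]
      positivity
  linarith

lemma norm_sq_le_split (x x₀ : H) (r r₀ : ℝ) :
    ‖x‖ ^ 2 ≤ 2 * ‖x - (r / r₀) • x₀‖ ^ 2 + 2 * ((‖x₀‖ / r₀) ^ 2 * r ^ 2) := by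
  have h : ‖x‖ ≤ ‖x - (r / r₀) • x₀‖ + ‖(r / r₀) • x₀‖ := by
    simpa using norm_add_le (x - (r / r₀) • x₀) ((r / r₀) • x₀)
  have e : ‖(r / r₀) • x₀‖ ^ 2 = (‖x₀‖ / r₀) ^ 2 * r ^ 2 := by
    rw [norm_smul, mul_pow, Real.norm_eq_abs, sq_abs]; ring
  have := norm_nonneg x
  have := norm_nonneg (x - (r / r₀) • x₀)
  rw [← e]
  nlinarith [sq_nonneg (‖x - (r / r₀) • x₀‖ - ‖(r / r₀) • x₀‖)]

/-- Split `dx` and `dy` into the shifted part and the multiple of `x`, `y`. The shifted parts need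
only `s/Q ≤ τ ≤ Q/r`; the coefficients of `ρ²` and `σ²` are exactly those bounded in
`eccentricity_bounds`. -/
lemma eccentricity_le_ellipseForm (hQ : 1 ≤ Q) (hV : V ∈ bellmanDomain H Q)
    (h2 : V.2.2.1 * V.2.2.2 ≤ Q) (dV : H × H × ℝ × ℝ) :
    eccentricity Q V * ‖dV.1‖ ^ 2 + (eccentricity Q V)⁻¹ * ‖dV.2.1‖ ^ 2 ≤
      Q * (50 * ellipseForm Q V dV) := by
  classical
  have hQ0 : 0 < Q := by linarith
  have hτs := le_eccentricity hQ hV h2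
  obtain ⟨x, y, r, s⟩ := V
  obtain ⟨dx, dy, ρ, σ⟩ := dV
  obtain ⟨hx, hy, hr, hs, -, -⟩ := hV
  dsimp only at *
  have hX : 0 < ‖x‖ := norm_pos_iff.2 hx
  have hY : 0 < ‖y‖ := norm_pos_iff.2 hy
  set τ := eccentricity Q (x, y, r, s) with hτ
  have hτ0 : 0 < τ := lt_of_lt_of_le (by positivity) hτs
  have hτr : τ ≤ Q / r := min_le_left _ _
  set χ : ℝ := if 2 * ‖x‖ ≤ r * ‖y‖ ∧ 2 * ‖y‖ ≤ s * ‖x‖ then 1 else 0 with hχ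
  have hχ0 : 0 ≤ χ := by rw [hχ]; split_ifs <;> norm_num
  obtain ⟨b1, b2⟩ := eccentricity_bounds (t := ‖y‖ / ‖x‖) hQ hr hs (by positivity) h2 hχ0
    (fun c1 c2 => by
      rw [hχ, if_pos]
      rw [mul_div_assoc', le_div_iff₀ hX] at c1
      rw [mul_div_assoc', div_le_iff₀ hX] at c2
      exact ⟨c1, c2⟩) hτ
  have sx := norm_sq_le_split dx x ρ r
  have sy := norm_sq_le_split dy y σ s
  have hform : ellipseForm Q (x, y, r, s) (dx, dy, ρ, σ) =
      ‖dx - (ρ / r) • x‖ ^ 2 / r + ‖dy - (σ / s) • y‖ ^ 2 / s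
      + (‖x‖ / r) ^ 2 * (s * ρ ^ 2 / Q ^ 2 + σ ^ 2 / s ^ 3)
      + (‖y‖ / s) ^ 2 * (r * σ ^ 2 / Q ^ 2 + ρ ^ 2 / r ^ 3)
      + χ * (‖x‖ / r * (‖y‖ / s) * ((s / r * ρ ^ 2 + r / s * σ ^ 2) / Q)) := by
    simp only [ellipseForm, hχ]
  rw [hform]
  set a := ‖dx - (ρ / r) • x‖ ^ 2
  set b := ‖dy - (σ / s) • y‖ ^ 2
  have ha : 0 ≤ a := by positivity
  have hb : 0 ≤ b := by positivity
  have hinv : τ⁻¹ ≤ Q / s := by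
    rw [inv_eq_one_div, div_le_div_iff₀ hτ0 hs]
    rw [div_le_iff₀ hQ0] at hτs
    linarith
  rw [one_div] at b2
  have u1 := mul_le_mul_of_nonneg_left sx hτ0.le
  have u2 := mul_le_mul_of_nonneg_left sy (inv_pos.2 hτ0).le
  have u3 := mul_le_mul_of_nonneg_right hτr ha
  have u4 := mul_le_mul_of_nonneg_right hinv hb
  have hpρ : 0 ≤ (‖x‖ / r) ^ 2 * ρ ^ 2 := by positivity
  have hqσ : 0 ≤ (‖y‖ / s) ^ 2 * σ ^ 2 := by positivity
  have u5 := mul_le_mul_of_nonneg_right b1 hpρ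
  have u6 := mul_le_mul_of_nonneg_right b2 hqσ
  have hrhs : Q * (50 * (a / r + b / s
      + (‖x‖ / r) ^ 2 * (s * ρ ^ 2 / Q ^ 2 + σ ^ 2 / s ^ 3)
      + (‖y‖ / s) ^ 2 * (r * σ ^ 2 / Q ^ 2 + ρ ^ 2 / r ^ 3)
      + χ * (‖x‖ / r * (‖y‖ / s) * ((s / r * ρ ^ 2 + r / s * σ ^ 2) / Q)))) =
      50 * (Q / r * a) + 50 * (Q / s * b)
      + 2 * (25 * (s / Q + Q * (‖y‖ / ‖x‖) ^ 2 / (r * s ^ 2) + χ * (‖y‖ / ‖x‖))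
        * ((‖x‖ / r) ^ 2 * ρ ^ 2))
      + 2 * (25 * (r / Q + Q / ((‖y‖ / ‖x‖) ^ 2 * r ^ 2 * s) + χ / (‖y‖ / ‖x‖))
        * ((‖y‖ / s) ^ 2 * σ ^ 2)) := by
    field_simp
    ring
  rw [hrhs]
  have z1 : 0 ≤ Q / r * a := by positivity
  have z2 : 0 ≤ Q / s * b := by positivity
  linarith

end Bellman

theorem mainTheorem5 :
    ∃ C : ℝ, 0 < C ∧
      ∀ (H : Type*) [NormedAddCommGroup H] [InnerProductSpace ℝ H] [CompleteSpace H]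
        [TopologicalSpace.SeparableSpace H] (Q ε ℓ : ℝ),
        1 ≤ Q → 0 < ε → 0 < ℓ → ℓ ≤ ε / 2 →
        ∃ (B : H × H × ℝ × ℝ → ℝ) (τ : H × H × ℝ × ℝ → ℝ),
          SmoothNear B (truncatedDomain H Q ε ℓ) ∧
          (∀ V ∈ truncatedDomain H Q ε ℓ,
            0 ≤ B V ∧
            B V ≤ C * ((1 + ℓ) * (‖V.1‖ ^ 2 / V.2.2.1 + ‖V.2.1‖ ^ 2 / V.2.2.2))) ∧
          (∀ V ∈ truncatedDomain H Q ε ℓ, ∀ dV : H × H × ℝ × ℝ,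
            2 / Q * (‖dV.1‖ * ‖dV.2.1‖) ≤ hessianForm B V dV) ∧
          (∀ V₀ ∈ truncatedDomain H Q ε ℓ, ∀ V ∈ truncatedDomain H Q ε ℓ,
            1 / Q * (‖V.1 - V₀.1‖ * ‖V.2.1 - V₀.2.1‖) ≤
              B V - B V₀ - fderiv ℝ B V₀ (V - V₀)) ∧
          ContinuousOn τ (truncatedDomain H Q ε ℓ) ∧
          (∀ V ∈ truncatedDomain H Q ε ℓ,
            C⁻¹ * (Q⁻¹ * ε) ≤ τ V ∧ τ V ≤ C * (Q * ε⁻¹)) ∧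
          (∀ V ∈ truncatedDomain H Q ε ℓ, ∀ dV : H × H × ℝ × ℝ,
            τ V * ‖dV.1‖ ^ 2 + (τ V)⁻¹ * ‖dV.2.1‖ ^ 2 ≤ Q * hessianForm B V dV) := by
  -- The size bound needs only `100 + 3600 + 6400`, and the bounds on `τ` need only `C ≥ 1`.
  refine ⟨20000, by norm_num, ?_⟩
  intro H _ _ _ _ Q ε ℓ hQ hε hℓ _
  have hQ0 : 0 < Q := by linarith
  -- The choice `δ = ℓ/4` turns `|x|, |y| ≥ ℓ` into the requirement `4δ ≤ |x|, |y|` of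
  -- `exists_maximizer`.
  have hδ : 0 < ℓ / 4 := by linarith
  have hsub := truncatedDomain_subset_bellmanDomain (H := H) (ε := ε) hQ hℓ
  have hlow : ∀ V ∈ truncatedDomain H Q ε ℓ, ε / Q ≤ eccentricity Q V := fun V hV => by
    refine le_trans ?_ (le_eccentricity hQ (hsub hV) hV.1.1.2.2.2)
    have := hV.1.2.2.2.1
    gcongr
  have hell : ∀ V ∈ truncatedDomain H Q ε ℓ, ∀ dV : H × H × ℝ × ℝ,
      eccentricity Q V * ‖dV.1‖ ^ 2 + (eccentricity Q V)⁻¹ * ‖dV.2.1‖ ^ 2 ≤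
        Q * hessianForm (bellman Q (ℓ / 4)) V dV := fun V hV dV => by
    have hV' := hsub hV
    obtain ⟨⟨⟨-, -, h1, h2⟩, -⟩, hx, hy⟩ := hV
    refine (eccentricity_le_ellipseForm hQ hV' h2 dV).trans ?_
    have := ellipseForm_le_hessianForm_bellman hQ hδ hV' h1 h2 (by linarith) (by linarith) dV
    gcongr
  refine ⟨bellman Q (ℓ / 4), eccentricity Q,
    ⟨_, isOpen_bellmanDomain, hsub, fun V hV => (contDiffAt_bellman hQ hδ hV).contDiffWithinAt⟩,
    fun V hV => ⟨bellman_nonneg hQ hδ (hsub hV), ?_⟩, fun V hV dV => ?_, fun V₀ hV₀ V hV => ?_,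
    (continuousOn_eccentricity Q hQ0).mono hsub, fun V hV => ⟨?_, ?_⟩, hell⟩
  · refine (bellman_le hQ hδ (hsub hV) hV.1.1.2.2.1 hV.1.1.2.2.2).trans ?_
    obtain ⟨⟨⟨hr, hs, -, -⟩, -⟩, -, -⟩ := hV
    gcongr
    exact le_mul_of_one_le_left (by positivity) (by linarith)
  · have h := hell V hV dV
    have hτ : 0 < eccentricity Q V := lt_of_lt_of_le (by positivity) (hlow V hV)
    -- AM-GM: the product of the two coefficients is `1`, so the ellipse bound implies continuous
    -- convexity.
    have h2 : 2 * (‖dV.1‖ * ‖dV.2.1‖) ≤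
        eccentricity Q V * ‖dV.1‖ ^ 2 + (eccentricity Q V)⁻¹ * ‖dV.2.1‖ ^ 2 :=
      mul_mul_le_of_sq_le hτ.le (inv_pos.2 hτ).le (by rw [mul_inv_cancel₀ hτ.ne']; norm_num) _ _
    rw [div_mul_eq_mul_div, div_le_iff₀ hQ0]
    linarith
  · obtain ⟨⟨⟨-, -, h1, h2⟩, -⟩, hx, hy⟩ := id hV₀
    exact mul_norm_sub_le_oneLeg_bellman hQ hδ (hsub hV₀) h1 h2 (by linarith) (by linarith)
      (hsub hV) hV.1.1.2.2.2
  · refine le_trans ?_ (hlow V hV)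
    rw [div_eq_inv_mul]
    have : 0 ≤ Q⁻¹ * ε := by positivity
    linarith
  · have hr : ε ≤ V.2.2.1 := hV.1.2.1
    have h1 : eccentricity Q V ≤ Q / V.2.2.1 := min_le_left _ _
    have h2 : Q / V.2.2.1 ≤ Q / ε := by gcongr
    have h3 : 0 ≤ Q / ε := by positivity
    rw [← div_eq_mul_inv]
    linarith
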